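/- Let $2<\tau<3$ and $h_{\min}>0$. For $n\ge 1$ consider the hidden-variable random graph on $n$ vertices: the hidden variables $h_1,\dots,h_n$ are i.i.d. with density $C h^{-\tau}$ on $[h_{\min},\infty)$ ($C$ the normalising constant) and mean $\mu$, and, conditionally on them, each pair $\{i,j\}$ of distinct vertices is joined independently with probability $\min\bigl(h_ih_j/(\mu n),1\bigr)$. For a fixed graph $H$ let $N(H)$ be the number of labelled, not necessarily induced copies of $H$, i.e. the number of injective maps from the vertices of $H$ to the vertices of the random graph that send edges to edges. Let $\triangle$ be the number of triangles (sets of three pairwise adjacent vertices), so that $N(K_3)=6\triangle$. Let the bow-tie be two triangles sharing exactly one vertex and the diamond two triangles sharing exactly one edge. Then, as $n\to\infty$ with $\tau$ and $h_{\min}$ fixed, $$\operatorname{Var}(N(K_3))=9\,\mathbb E[N(\text{bow-tie})]+18\,\mathbb E[N(\text{diamond})]+6\,\mathbb E[N(K_3)]+O(n^{-1})\,\mathbb E[N(K_3)]^2 .$$ Moreover, $$\frac{\operatorname{Var}(\triangle)}{\mathbb E[\triangle]^2}=\begin{cases}\Theta\bigl(n^{(\tau-3)/2}\bigr), & \tau<7/3,\\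 \Theta\bigl(n^{2\tau-5}\log n\bigr)=\Theta\bigl(n^{-1/3}\log n\bigr), & \tau=7/3,\\ \Theta\bigl(n^{2\tau-5}\bigr), & \tau>7/3.\end{cases}$$ Consequently $$\lim_{n\to\infty}\frac{\operatorname{Var}(\triangle)}{\mathbb E[\triangle]^2}=\begin{cases}0,&\tau<5/2,\\ \infty,&\tau>5/2,\end{cases}$$ and the ratio is $\Theta(1)$ for $\tau=5/2$. In particular the number of triangles is self-averaging (the ratio tends to $0$) if and only if $\tau<5/2$. -/

import Mathlib

open MeasureTheory ProbabilityTheory Filter Asymptotics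
open scoped Topology

namespace HiddenVariable

/-- The law of one hidden variable: the probability measure on `ℝ` with density `C * h ^ (-τ)` for
`h ≥ hmin`, where the normalisation forces `C = (τ - 1) * hmin ^ (τ - 1)`. This is the Pareto law
with scale `hmin` and shape `τ - 1`. -/
noncomputable def weightLaw (τ hmin : ℝ) : Measure ℝ := paretoMeasure hmin (τ - 1)

/-- The mean `μ` of a hidden variable. -/
noncomputable def meanWeight (τ hmin : ℝ) : ℝ := ∫ h, h ∂(weightLaw τ hmin)

/-- The connection probability `p(h, h') = min (h h' / (μ n)) 1`. -/
noncomputable def connProb (τ hmin : ℝ) (n : ℕ) (h h' : ℝ) : ℝ :=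
  min (h * h' / (meanWeight τ hmin * n)) 1

/-- The sample space of the model on `n` vertices: a hidden variable for every vertex and a
label for every unordered pair of vertices (labels of diagonal pairs are never used). -/
abbrev Sample (n : ℕ) : Type := (Fin n → ℝ) × (Sym2 (Fin n) → ℝ)

/-- The hidden variables are i.i.d. with law `weightLaw`, the labels are i.i.d. uniform on `[0, 1]`,
and the two families are independent. -/
noncomputable def sampleLaw (τ hmin : ℝ) (n : ℕ) : Measure (Sample n) :=
  (Measure.pi fun _ : Fin n => weightLaw τ hmin).prod
    (Measure.pi fun _ : Sym2 (Fin n) => (volume : Measure ℝ).restrict (Set.Icc 0 1))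

/-- The random graph: distinct vertices `i`, `j` are joined when the uniform label of the pair
`{i, j}` is at most `p(h_i, h_j)`. Thus, conditionally on the hidden variables, the pairs are joined
independently, the pair `{i, j}` with probability `p(h_i, h_j)`. -/
noncomputable def randomGraph (τ hmin : ℝ) (n : ℕ) (ω : Sample n) : SimpleGraph (Fin n) where
  Adj i j := i ≠ j ∧ ω.2 s(i, j) ≤ connProb τ hmin n (ω.1 i) (ω.1 j)
  symm := ⟨fun i j h => by
    refine ⟨h.1.symm, ?_⟩
    have h2 := h.2
    rw [Sym2.eq_swap]
    simpa only [connProb, mul_comm (ω.1 j) (ω.1 i)] using h2⟩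
  loopless := ⟨fun _ h => h.1 rfl⟩

/-- The expectation of a graph statistic in the hidden-variable model on `n` vertices. -/
noncomputable def expect (τ hmin : ℝ) (n : ℕ) (X : SimpleGraph (Fin n) → ℝ) : ℝ :=
  ∫ ω, X (randomGraph τ hmin n ω) ∂(sampleLaw τ hmin n)

/-- The variance of a graph statistic in the hidden-variable model on `n` vertices. -/
noncomputable def var (τ hmin : ℝ) (n : ℕ) (X : SimpleGraph (Fin n) → ℝ) : ℝ :=
  variance (fun ω => X (randomGraph τ hmin n ω)) (sampleLaw τ hmin n)

/-- The triangle. -/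
def triangle : SimpleGraph (Fin 3) := ⊤

/-- The bow-tie: two triangles sharing exactly the vertex `0`. -/
def bowTie : SimpleGraph (Fin 5) :=
  SimpleGraph.fromEdgeSet {s(0, 1), s(0, 2), s(1, 2), s(0, 3), s(0, 4), s(3, 4)}

/-- The diamond: two triangles sharing exactly the edge `{0, 1}`. -/
def diamond : SimpleGraph (Fin 4) :=
  SimpleGraph.fromEdgeSet {s(0, 1), s(0, 2), s(1, 2), s(0, 3), s(1, 3)}

/-- The motif count `N(H)`: the number of labelled, not necessarily induced copies of `H` in `G`,
that is, of injective maps from the vertices of `H` to those of `G` sending edges to edges. -/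
noncomputable def motifCount {k n : ℕ} (H : SimpleGraph (Fin k)) (G : SimpleGraph (Fin n)) : ℝ :=
  (G.labelledCopyCount H : ℝ)

/-- The number `△` of triangles of `G`: sets of three pairwise adjacent vertices. -/
noncomputable def triangleCount {n : ℕ} (G : SimpleGraph (Fin n)) : ℝ :=
  ((G.cliqueSet 3).ncard : ℝ)

/-- The relative fluctuation `Var(△) / E[△]²` in the model on `n` vertices. -/
noncomputable def relFluct (τ hmin : ℝ) (n : ℕ) : ℝ :=
  var τ hmin n triangleCount / expect τ hmin n triangleCount ^ 2

end HiddenVariable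

/-!
Writing the triangle count as a sum of indicators over triples, the variance is a sum of
covariances over pairs of triples. Disjoint triples are uncorrelated; pairs sharing one, two or
three vertices give the bow-tie, diamond and triangle densities, minus multiples of the squared
triangle density, and the latter are of relative order `n⁻¹`.

Let `N = μ n` and let `T x` be the probability that a vertex of weight `x` forms a triangle with two
given vertices, so that the triangle and bow-tie densities are `E[T h]` and `E[(T h) ^ 2]`. Below
`√N` the probability `T x` is bounded by powers of `x`; between `√N` and `N / hmin` it is of order
`N ^ (1 - 2 * (τ - 1)) * x ^ (2 * (τ - 2))`. The triangle density is governed by `x ≈ √N`, whereas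
the bow-tie density is governed by `∫ t in √N..N / hmin, t ^ (3 * τ - 8)`, whose dominant end
changes from `√N` to `N` at `τ = 7 / 3`. In the diamond, bounding every edge probability by
`(x y / N) ^ s` with `s` slightly below `(τ - 1) / 2` leaves a contribution of smaller order.
-/


namespace HiddenVariable

open Finset

section Containment

variable {V V' : Type*}

open Classical in
/-- The indicator of the event that the graph `G` contains all the edges of `H`. -/
noncomputable def containInd (H G : SimpleGraph V) : ℝ := if H ≤ G then 1 else 0

lemma containInd_mul_containInd (H H' G : SimpleGraph V) :
    containInd H G * containInd H' G = containInd (H ⊔ H') G := by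
  by_cases h : H ≤ G <;> by_cases h' : H' ≤ G <;> simp [containInd, h, h']

lemma norm_containInd_le_one (H G : SimpleGraph V) : ‖containInd H G‖ ≤ 1 := by
  unfold containInd
  split_ifs <;> simp

lemma motifCount_eq_sum_containInd {k n : ℕ} (H : SimpleGraph (Fin k)) (G : SimpleGraph (Fin n)) :
    motifCount H G = ∑ f : Fin k ↪ Fin n, containInd (H.map f) G := by
  classical
  let copyEquiv : SimpleGraph.Copy H G ≃ {f : Fin k ↪ Fin n // H.map f ≤ G} :=
    { toFun := fun c => ⟨c.toEmbedding, (SimpleGraph.map_le_iff_le_comap _ _ _).2 c.toHom.le_comap⟩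
      invFun := fun f =>
        ⟨⟨f.1, fun h => (SimpleGraph.map_le_iff_le_comap _ _ _).1 f.2 h⟩, f.1.injective⟩
      left_inv := fun _ => rfl
      right_inv := fun _ => rfl }
  calc motifCount H G = Fintype.card {f : Fin k ↪ Fin n // H.map f ≤ G} := by
        rw [motifCount, SimpleGraph.labelledCopyCount, ← Fintype.card_congr copyEquiv]
        congr!
    _ = ∑ f : Fin k ↪ Fin n, containInd (H.map f) G := by
        simp only [containInd, Fintype.card_subtype, Finset.card_filter, Nat.cast_sum,
          Nat.cast_ite, Nat.cast_one, Nat.cast_zero]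

/-- The complete graph on the vertices in `s`, with all other vertices isolated. -/
def cliqueOn (s : Finset V) : SimpleGraph V :=
  (⊤ : SimpleGraph s).map (Function.Embedding.subtype _)

lemma cliqueOn_adj {s : Finset V} {a b : V} : (cliqueOn s).Adj a b ↔ a ≠ b ∧ a ∈ s ∧ b ∈ s := by
  simp only [cliqueOn, SimpleGraph.map_adj, SimpleGraph.top_adj]
  aesop

lemma cliqueOn_le_iff {s : Finset V} {G : SimpleGraph V} :
    cliqueOn s ≤ G ↔ G.IsClique (s : Set V) :=
  ⟨fun h _ ha _ hb hab => h (cliqueOn_adj.2 ⟨hab, ha, hb⟩),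
    fun h _ _ hab => h (cliqueOn_adj.1 hab).2.1 (cliqueOn_adj.1 hab).2.2 (cliqueOn_adj.1 hab).1⟩

lemma disjoint_cliqueOn {s t : Finset V} (h : Disjoint s t) :
    Disjoint (cliqueOn s) (cliqueOn t) := by
  rw [SimpleGraph.disjoint_left]
  exact fun a b hs ht => disjoint_left.1 h (cliqueOn_adj.1 hs).2.1 (cliqueOn_adj.1 ht).2.1

lemma map_top_eq_cliqueOn [Fintype V] (f : V ↪ V') :
    (⊤ : SimpleGraph V).map f = cliqueOn (univ.map f) := by
  ext a b
  simp only [SimpleGraph.map_adj, SimpleGraph.top_adj, cliqueOn_adj]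
  aesop

lemma exists_map_univ_eq {s : Finset V} {k : ℕ} (hs : #s = k) : ∃ f : Fin k ↪ V, univ.map f = s :=
  ⟨(s.equivFinOfCardEq hs).symm.toEmbedding.trans (Function.Embedding.subtype _), by
    rw [← Finset.map_map, map_univ_equiv]
    exact attach_map_val⟩

lemma card_filter_map_univ_eq [Fintype V] [DecidableEq V] {s : Finset V} {k : ℕ} (hs : #s = k) :
    #{f : Fin k ↪ V | univ.map f = s} = k.factorial := by
  have h : #{f : Fin k ↪ V | univ.map f = s} = Fintype.card (Fin k ↪ s) := by
    symm
    refine card_bij (fun f _ => f.trans (Function.Embedding.subtype _)) (fun f _ => ?_)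
      (fun f _ g _ h => ?_) fun f hf => ?_
    · refine mem_filter.2 ⟨mem_univ _, eq_of_subset_of_card_le (fun x hx => ?_) (by simp [hs])⟩
      obtain ⟨i, -, rfl⟩ := mem_map.1 hx
      exact (f i).2
    · ext i
      simpa using DFunLike.congr_fun h i
    · have hmem : ∀ i, f i ∈ s := fun i => (mem_filter.1 hf).2 ▸ mem_map_of_mem f (mem_univ i)
      exact ⟨f.codRestrict s hmem, mem_univ _, rfl⟩
  rw [h, Fintype.card_embedding_eq, Fintype.card_coe, Fintype.card_fin, hs, Nat.descFactorial_self]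

lemma ncard_cliqueSet_eq_sum_containInd [Fintype V] (k : ℕ) (G : SimpleGraph V) :
    ((G.cliqueSet k).ncard : ℝ) = ∑ s ∈ powersetCard k univ, containInd (cliqueOn s) G := by
  classical
  have h : G.cliqueSet k = ({s ∈ powersetCard k univ | cliqueOn s ≤ G} : Finset (Finset V)) := by
    ext s
    simp [SimpleGraph.mem_cliqueSet_iff, SimpleGraph.isNClique_iff, cliqueOn_le_iff, and_comm]
  simp only [h, Set.ncard_coe_finset, card_filter, containInd, Nat.cast_sum, Nat.cast_ite,
    Nat.cast_one, Nat.cast_zero]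

lemma motifCount_top_eq_factorial_mul {k n : ℕ} (G : SimpleGraph (Fin n)) :
    motifCount (⊤ : SimpleGraph (Fin k)) G = k.factorial * (G.cliqueSet k).ncard := by
  have hmaps : ∀ f ∈ (univ : Finset (Fin k ↪ Fin n)), univ.map f ∈ powersetCard k univ :=
    fun f _ => mem_powersetCard.2 ⟨subset_univ _, by simp⟩
  rw [motifCount_eq_sum_containInd, ncard_cliqueSet_eq_sum_containInd, mul_sum,
    ← sum_fiberwise_of_maps_to hmaps]
  refine sum_congr rfl fun s hs => ?_
  rw [← card_filter_map_univ_eq (mem_powersetCard.1 hs).2, ← nsmul_eq_mul, ← sum_const]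
  refine sum_congr rfl fun f hf => ?_
  rw [map_top_eq_cliqueOn, (mem_filter.1 hf).2]

lemma motifCount_triangle {n : ℕ} (G : SimpleGraph (Fin n)) :
    motifCount triangle G = 6 * triangleCount G := by
  rw [triangle, motifCount_top_eq_factorial_mul, triangleCount]
  norm_num [Nat.factorial]

lemma card_filter_card_inter_eq [Fintype V] [DecidableEq V] (s : Finset V) {j k : ℕ} (hk : k ≤ j) :
    #{t ∈ powersetCard j univ | #(s ∩ t) = k}
      = (#s).choose k * (Fintype.card V - #s).choose (j - k) := by
  rw [← card_compl, ← card_powersetCard, ← card_powersetCard, ← card_product]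
  refine card_nbij' (fun t => (s ∩ t, sᶜ ∩ t)) (fun p => p.1 ∪ p.2) ?_ ?_ ?_ ?_
  · intro t ht
    have hsplit : #(s ∩ t) + #(sᶜ ∩ t) = #t := by
      rw [← card_union_of_disjoint (disjoint_compl_right.mono inter_subset_left inter_subset_left),
        ← union_inter_distrib_right, union_compl, univ_inter]
    simp only [coe_filter, mem_powersetCard, Set.mem_ofPred_eq, subset_univ, true_and] at ht
    simp only [coe_product, Set.mem_prod, mem_coe, mem_powersetCard, inter_subset_left, true_and]
    omega
  · rintro ⟨a, b⟩ h
    simp only [coe_product, Set.mem_prod, mem_coe, mem_powersetCard] at h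
    obtain ⟨⟨ha, hak⟩, hb, hbk⟩ := h
    have hsa : s ∩ (a ∪ b) = a := by grind [mem_compl]
    simp only [coe_filter, mem_powersetCard, Set.mem_ofPred_eq, subset_univ, true_and, hsa, hak,
      and_true]
    rw [card_union_of_disjoint (disjoint_compl_right.mono ha hb)]
    omega
  · intro t _
    grind [mem_compl]
  · rintro ⟨a, b⟩ h
    simp only [coe_product, Set.mem_prod, mem_coe, mem_powersetCard] at h
    obtain ⟨⟨ha, -⟩, hb, -⟩ := h
    ext x <;> grind [mem_compl]

lemma sum_filter_card_inter_eq [Fintype V] [DecidableEq V] {s : Finset V} {j k : ℕ} (hk : k ≤ j)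
    {F : Finset V → ℝ} {c : ℝ} (hF : ∀ t, #t = j → #(s ∩ t) = k → F t = c) :
    ∑ t ∈ powersetCard j univ with #(s ∩ t) = k, F t
      = (#s).choose k * (Fintype.card V - #s).choose (j - k) * c := by
  rw [← Nat.cast_mul, ← card_filter_card_inter_eq s hk, ← nsmul_eq_mul, ← sum_const]
  refine sum_congr rfl fun t ht => ?_
  obtain ⟨htj, htk⟩ := mem_filter.1 ht
  exact hF t (mem_powersetCard.1 htj).2 htk

lemma map_cliqueOn (f : V ↪ V') (s : Finset V) : (cliqueOn s).map f = cliqueOn (s.map f) := by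
  ext a b
  simp only [SimpleGraph.map_adj, cliqueOn_adj]
  aesop

lemma map_cliqueOn_sup (f : V ↪ V') (s t : Finset V) :
    (cliqueOn s ⊔ cliqueOn t).map f = cliqueOn (s.map f) ⊔ cliqueOn (t.map f) := by
  rw [← map_cliqueOn, ← map_cliqueOn]
  ext a b
  simp only [SimpleGraph.map_adj, SimpleGraph.sup_adj]
  grind

lemma bowTie_eq_sup : bowTie = cliqueOn {0, 1, 2} ⊔ cliqueOn {0, 3, 4} := by
  ext a b
  simp only [bowTie, SimpleGraph.fromEdgeSet_adj, SimpleGraph.sup_adj, cliqueOn_adj]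
  fin_cases a <;> fin_cases b <;> simp

lemma diamond_eq_sup : diamond = cliqueOn {0, 1, 2} ⊔ cliqueOn {0, 1, 3} := by
  ext a b
  simp only [diamond, SimpleGraph.fromEdgeSet_adj, SimpleGraph.sup_adj, cliqueOn_adj]
  fin_cases a <;> fin_cases b <;> simp

lemma exists_map_bowTie_eq [DecidableEq V] {s t : Finset V} (hs : #s = 3) (ht : #t = 3)
    (h : #(s ∩ t) = 1) : ∃ f : Fin 5 ↪ V, bowTie.map f = cliqueOn s ⊔ cliqueOn t := by
  obtain ⟨a, hst⟩ := card_eq_one.1 h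
  obtain ⟨b, c, hbc, hs'⟩ := card_eq_two.1 (show #(s \ t) = 2 by grind)
  obtain ⟨d, e, hde, ht'⟩ := card_eq_two.1 (show #(t \ s) = 2 by grind)
  simp only [Finset.ext_iff, mem_inter, Finset.mem_sdiff, mem_insert, mem_singleton] at hst hs' ht'
  have hinj : Function.Injective ![a, b, c, d, e] := by
    have hdistinct : [a, b, c, d, e].Nodup := by grind [hst a, hs' b, hs' c, ht' d, ht' e]
    exact List.nodup_ofFn.1 hdistinct
  refine ⟨⟨_, hinj⟩, ?_⟩
  rw [bowTie_eq_sup, map_cliqueOn_sup]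
  congr 2 <;> ext x <;>
  · simp only [map_insert, map_singleton, Function.Embedding.coeFn_mk, Matrix.cons_val, mem_insert,
      mem_singleton]
    grind

lemma exists_map_diamond_eq [DecidableEq V] {s t : Finset V} (hs : #s = 3) (ht : #t = 3)
    (h : #(s ∩ t) = 2) : ∃ f : Fin 4 ↪ V, diamond.map f = cliqueOn s ⊔ cliqueOn t := by
  obtain ⟨a, b, hab, hst⟩ := card_eq_two.1 h
  obtain ⟨c, hs'⟩ := card_eq_one.1 (show #(s \ t) = 1 by grind)
  obtain ⟨d, ht'⟩ := card_eq_one.1 (show #(t \ s) = 1 by grind)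
  simp only [Finset.ext_iff, mem_inter, Finset.mem_sdiff, mem_insert, mem_singleton] at hst hs' ht'
  have hinj : Function.Injective ![a, b, c, d] := by
    have hdistinct : [a, b, c, d].Nodup := by grind [hst a, hst b, hs' c, ht' d]
    exact List.nodup_ofFn.1 hdistinct
  refine ⟨⟨_, hinj⟩, ?_⟩
  rw [diamond_eq_sup, map_cliqueOn_sup]
  congr 2 <;> ext x <;>
  · simp only [map_insert, map_singleton, Function.Embedding.coeFn_mk, Matrix.cons_val, mem_insert,
      mem_singleton]
    grind

end Containment

section EdgeWeight

variable {V V' Ω : Type*} {U : Sym2 Ω → ℝ}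

lemma measurable_apply_sym2Map [MeasurableSpace Ω]
    (hU : Measurable fun p : Ω × Ω => U s(p.1, p.2)) (e : Sym2 V) :
    Measurable fun x : V → Ω => U (e.map x) := by
  induction e with
  | _ a b =>
    have hpair : Measurable fun x : V → Ω => (x a, x b) := by fun_prop
    exact hU.comp hpair

variable [Fintype V] [Fintype V']

open Classical in
/-- The weight of the graph `H` with vertices placed at the points `x`: the product over the edges
of `H` of the values of the symmetric function `U`, encoded as a function of unordered pairs. -/
noncomputable def edgeWeight (U : Sym2 Ω → ℝ) (H : SimpleGraph V) (x : V → Ω) : ℝ :=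
  ∏ e ∈ H.edgeFinset, U (e.map x)

lemma edgeWeight_map (f : V ↪ V') (H : SimpleGraph V) (x : V' → Ω) :
    edgeWeight U (H.map f) x = edgeWeight U H (x ∘ f) := by
  classical
  calc edgeWeight U (H.map f) x = ∏ e ∈ H.edgeFinset.map f.sym2Map, U (e.map x) := by
        unfold edgeWeight
        congr 1
        convert SimpleGraph.edgeFinset_map f H
    _ = edgeWeight U H (x ∘ f) := by
        simp only [prod_map, Function.Embedding.sym2Map_apply, Sym2.map_map, edgeWeight]

lemma edgeWeight_fromEdgeSet {E : Finset (Sym2 V)} (hE : ∀ e ∈ E, ¬ e.IsDiag) (x : V → Ω) :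
    edgeWeight U (SimpleGraph.fromEdgeSet (E : Set (Sym2 V))) x = ∏ e ∈ E, U (e.map x) := by
  unfold edgeWeight
  congr 1
  rw [← coe_inj, SimpleGraph.coe_edgeFinset, SimpleGraph.edgeSet_fromEdgeSet]
  exact sdiff_eq_left.2 (Set.disjoint_left.2 hE)

lemma edgeWeight_sup_of_disjoint {H H' : SimpleGraph V} (h : Disjoint H H') (x : V → Ω) :
    edgeWeight U (H ⊔ H') x = edgeWeight U H x * edgeWeight U H' x := by
  classical
  unfold edgeWeight
  rw [← prod_union (SimpleGraph.disjoint_edgeFinset.2 h)]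
  congr 1
  simp

lemma edgeWeight_mem_Icc (hU : ∀ e, U e ∈ Set.Icc 0 1) (H : SimpleGraph V) (x : V → Ω) :
    edgeWeight U H x ∈ Set.Icc 0 1 :=
  ⟨prod_nonneg fun _ _ => (hU _).1, prod_le_one (fun _ _ => (hU _).1) fun _ _ => (hU _).2⟩

variable [MeasurableSpace Ω]

lemma measurable_edgeWeight (hU : Measurable fun p : Ω × Ω => U s(p.1, p.2))
    (H : SimpleGraph V) : Measurable (edgeWeight U H) :=
  Finset.measurable_fun_prod _ fun e _ => measurable_apply_sym2Map hU e

end EdgeWeight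

section HomDensity

variable {V V' Ω : Type*} [Fintype V] [Fintype V'] [MeasurableSpace Ω]

/-- The homomorphism density of `H` in the weighted graph `U` on the probability space `(Ω, P)`: the
mean weight of `H` when its vertices are placed independently with law `P`. -/
noncomputable def homDensity (P : Measure Ω) (U : Sym2 Ω → ℝ) (H : SimpleGraph V) : ℝ :=
  ∫ x, edgeWeight U H x ∂(Measure.pi fun _ => P)

variable {P : Measure Ω} [IsProbabilityMeasure P] {U : Sym2 Ω → ℝ}

lemma measurePreserving_pi_comp (f : V ↪ V') :
    MeasurePreserving (fun x : V' → Ω => x ∘ f) (Measure.pi fun _ => P)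
      (Measure.pi fun _ => P) := by
  have hcoord : iIndepFun (fun i (x : V' → Ω) => x (f i)) (Measure.pi fun _ => P) :=
    (iIndepFun_pi (X := fun _ => id) fun _ => aemeasurable_id).precomp f.injective
  refine ⟨measurable_pi_lambda _ fun i => measurable_pi_apply (f i), ?_⟩
  refine (hcoord.map_fun_eq_pi_map fun i => (measurable_pi_apply (f i)).aemeasurable).trans ?_
  congr with i : 1
  exact (measurePreserving_eval (fun _ => P) (f i)).map_eq

lemma homDensity_map (hU : Measurable fun p : Ω × Ω => U s(p.1, p.2)) (f : V ↪ V')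
    (H : SimpleGraph V) : homDensity P U (H.map f) = homDensity P U H := by
  have hf := measurePreserving_pi_comp (P := P) f
  simp only [homDensity, edgeWeight_map]
  rw [← hf.map_eq, integral_map hf.measurable.aemeasurable
    (measurable_edgeWeight hU H).aestronglyMeasurable]

lemma homDensity_cliqueOn_sup_of_disjoint (hU : Measurable fun p : Ω × Ω => U s(p.1, p.2))
    {s t : Finset V} (hst : Disjoint s t) :
    homDensity P U (cliqueOn s ⊔ cliqueOn t)
      = homDensity P U (cliqueOn s) * homDensity P U (cliqueOn t) := by
  have hindep : iIndepFun (fun i (x : V → Ω) => x i) (Measure.pi fun _ => P) :=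
    iIndepFun_pi (X := fun _ => id) fun _ => aemeasurable_id
  have hrestrict := (hindep.indepFun_finset s t hst measurable_pi_apply).comp
    (measurable_edgeWeight hU (⊤ : SimpleGraph s)) (measurable_edgeWeight hU (⊤ : SimpleGraph t))
  have hclique : ∀ r : Finset V, edgeWeight U (cliqueOn r)
      = edgeWeight U (⊤ : SimpleGraph r) ∘ fun x i => x i :=
    fun r => funext fun x => edgeWeight_map _ _ x
  simp only [homDensity, edgeWeight_sup_of_disjoint (disjoint_cliqueOn hst)]
  simp only [← hclique] at hrestrict
  exact hrestrict.integral_fun_mul_eq_mul_integral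
    (measurable_edgeWeight hU _).aestronglyMeasurable
    (measurable_edgeWeight hU _).aestronglyMeasurable

end HomDensity

section KernelGraph

variable {V Ω : Type*}

/-- The graph with vertices at the points `ω.1` in which distinct `i` and `j` are joined when the
label of `{i, j}` is at most the kernel `W` at the two points; under `kernelGraphLaw` it is the
inhomogeneous random graph with kernel `W`. -/
def kernelGraph (W : Sym2 Ω → ℝ) (ω : (V → Ω) × (Sym2 V → ℝ)) : SimpleGraph V where
  Adj i j := i ≠ j ∧ ω.2 s(i, j) ≤ W s(ω.1 i, ω.1 j)
  symm := ⟨fun i j h => ⟨h.1.symm, by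
    rw [Sym2.eq_swap (a := j), Sym2.eq_swap (a := ω.1 j)]
    exact h.2⟩⟩
  loopless := ⟨fun _ h => h.1 rfl⟩

/-- The joint law of the points and labels of an inhomogeneous random graph: the points are i.i.d.
with law `P`, the labels are i.i.d. uniform on `[0, 1]` and independent of the points. -/
noncomputable def kernelGraphLaw (V : Type*) [Fintype V] [MeasurableSpace Ω] (P : Measure Ω) :
    Measure ((V → Ω) × (Sym2 V → ℝ)) :=
  (Measure.pi fun _ => P).prod (Measure.pi fun _ => (volume : Measure ℝ).restrict (Set.Icc 0 1))

/-- The probability that a uniform label is at most the kernel `W`. -/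
def edgeProb (W : Sym2 Ω → ℝ) (e : Sym2 Ω) : ℝ := max 0 (min (W e) 1)

variable {W : Sym2 Ω → ℝ}

lemma edgeProb_mem_Icc (e : Sym2 Ω) : edgeProb W e ∈ Set.Icc 0 1 :=
  ⟨le_max_left _ _, max_le zero_le_one (min_le_right _ _)⟩

open Classical in
lemma containInd_kernelGraph [Fintype V] (H : SimpleGraph V) (ω : (V → Ω) × (Sym2 V → ℝ)) :
    containInd H (kernelGraph W ω)
      = ∏ e ∈ H.edgeFinset, if ω.2 e ≤ W (e.map ω.1) then 1 else 0 := by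
  have hle : H ≤ kernelGraph W ω ↔ ∀ e ∈ H.edgeFinset, ω.2 e ≤ W (e.map ω.1) := by
    simp only [SimpleGraph.mem_edgeFinset, Sym2.forall, SimpleGraph.mem_edgeSet, Sym2.map_mk]
    exact ⟨fun h a b hab => (h hab).2, fun h a b hab => ⟨hab.ne, h a b hab⟩⟩
  rw [prod_boole]
  simp only [containInd, hle]
  congr

instance : IsProbabilityMeasure ((volume : Measure ℝ).restrict (Set.Icc 0 1)) := ⟨by simp⟩

lemma integral_uniform_ite_le (c : ℝ) :
    ∫ u in Set.Icc (0 : ℝ) 1, (if u ≤ c then (1 : ℝ) else 0) = max 0 (min c 1) := by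
  have hind : (fun u : ℝ => if u ≤ c then (1 : ℝ) else 0)
      = (Set.Iic c).indicator fun _ => (1 : ℝ) := by
    ext u
    simp only [Set.indicator_apply, Set.mem_Iic]
  have hset : Set.Icc (0 : ℝ) 1 ∩ Set.Iic c = Set.Icc 0 (min c 1) := by
    grind
  rw [hind, setIntegral_indicator measurableSet_Iic, hset]
  simp [max_comm]

lemma integral_uniform_prod_ite_le {ι : Type*} [Fintype ι] (E : Finset ι) (c : ι → ℝ) :
    ∫ u : ι → ℝ, ∏ e ∈ E, (if u e ≤ c e then (1 : ℝ) else 0)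
      ∂(Measure.pi fun _ => (volume : Measure ℝ).restrict (Set.Icc 0 1))
      = ∏ e ∈ E, max 0 (min (c e) 1) := by
  classical
  simp only [← Fintype.prod_ite_mem E]
  rw [integral_fintype_prod_eq_prod
    (f := fun e v => if e ∈ E then (if v ≤ c e then (1 : ℝ) else 0) else 1)]
  refine prod_congr rfl fun e _ => ?_
  split_ifs
  · exact integral_uniform_ite_le (c e)
  · simp

variable [MeasurableSpace Ω]

lemma measurable_edgeProb (hW : Measurable fun p : Ω × Ω => W s(p.1, p.2)) :
    Measurable fun p : Ω × Ω => edgeProb W s(p.1, p.2) :=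
  measurable_const.max (hW.min measurable_const)

variable [Fintype V] {P : Measure Ω} [IsProbabilityMeasure P]

instance : IsProbabilityMeasure (kernelGraphLaw V P) := by
  unfold kernelGraphLaw
  infer_instance

lemma memLp_containInd (hW : Measurable fun p : Ω × Ω => W s(p.1, p.2)) (H : SimpleGraph V)
    (p : ENNReal) :
    MemLp (fun ω => containInd H (kernelGraph W ω)) p (kernelGraphLaw V P) := by
  have hmeas : Measurable fun ω : (V → Ω) × (Sym2 V → ℝ) => containInd H (kernelGraph W ω) := by
    simp only [containInd_kernelGraph]
    refine Finset.measurable_fun_prod _ fun e _ => Measurable.ite (measurableSet_le ?_ ?_)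
      measurable_const measurable_const
    · fun_prop
    · exact (measurable_apply_sym2Map hW e).comp measurable_fst
  exact MemLp.of_bound hmeas.aestronglyMeasurable 1
    (ae_of_all _ fun _ => norm_containInd_le_one _ _)

lemma integral_containInd (hW : Measurable fun p : Ω × Ω => W s(p.1, p.2)) (H : SimpleGraph V) :
    ∫ ω, containInd H (kernelGraph W ω) ∂(kernelGraphLaw V P) = homDensity P (edgeProb W) H := by
  have hint : Integrable (fun ω => containInd H (kernelGraph W ω)) (kernelGraphLaw V P) :=
    memLp_one_iff_integrable.1 (memLp_containInd hW H 1)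
  rw [kernelGraphLaw, integral_prod _ hint, homDensity]
  simp only [containInd_kernelGraph, edgeWeight, integral_uniform_prod_ite_le, edgeProb]

lemma integral_motifCount {k n : ℕ} (hW : Measurable fun p : Ω × Ω => W s(p.1, p.2))
    (H : SimpleGraph (Fin k)) :
    ∫ ω, motifCount H (kernelGraph W ω) ∂(kernelGraphLaw (Fin n) P)
      = n.descFactorial k * homDensity P (edgeProb W) H := by
  simp only [motifCount_eq_sum_containInd]
  rw [integral_finsetSum _ fun f _ => memLp_one_iff_integrable.1 (memLp_containInd hW _ 1)]
  simp only [integral_containInd hW, homDensity_map (measurable_edgeProb hW), sum_const, card_univ,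
    Fintype.card_embedding_eq, Fintype.card_fin, nsmul_eq_mul]

lemma covariance_containInd (hW : Measurable fun p : Ω × Ω => W s(p.1, p.2))
    (H H' : SimpleGraph V) :
    cov[fun ω => containInd H (kernelGraph W ω), fun ω => containInd H' (kernelGraph W ω);
        kernelGraphLaw V P]
      = homDensity P (edgeProb W) (H ⊔ H')
        - homDensity P (edgeProb W) H * homDensity P (edgeProb W) H' := by
  rw [covariance_eq_sub (memLp_containInd hW H 2) (memLp_containInd hW H' 2)]
  simp only [Pi.mul_apply, containInd_mul_containInd, integral_containInd hW]

end KernelGraph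

section TriangleVariance

variable {V Ω : Type*} [Fintype V] [MeasurableSpace Ω] {P : Measure Ω} [IsProbabilityMeasure P]
  {U W : Sym2 Ω → ℝ}

lemma homDensity_cliqueOn (hU : Measurable fun p : Ω × Ω => U s(p.1, p.2)) {s : Finset V} {k : ℕ}
    (hs : #s = k) : homDensity P U (cliqueOn s) = homDensity P U (⊤ : SimpleGraph (Fin k)) := by
  obtain ⟨f, rfl⟩ := exists_map_univ_eq hs
  rw [← map_top_eq_cliqueOn, homDensity_map hU]

lemma homDensity_cliqueOn_sup_of_card_inter_eq_one [DecidableEq V]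
    (hU : Measurable fun p : Ω × Ω => U s(p.1, p.2)) {s t : Finset V} (hs : #s = 3) (ht : #t = 3)
    (hst : #(s ∩ t) = 1) :
    homDensity P U (cliqueOn s ⊔ cliqueOn t) = homDensity P U bowTie := by
  obtain ⟨f, hf⟩ := exists_map_bowTie_eq hs ht hst
  rw [← hf, homDensity_map hU]

lemma homDensity_cliqueOn_sup_of_card_inter_eq_two [DecidableEq V]
    (hU : Measurable fun p : Ω × Ω => U s(p.1, p.2)) {s t : Finset V} (hs : #s = 3) (ht : #t = 3)
    (hst : #(s ∩ t) = 2) :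
    homDensity P U (cliqueOn s ⊔ cliqueOn t) = homDensity P U diamond := by
  obtain ⟨f, hf⟩ := exists_map_diamond_eq hs ht hst
  rw [← hf, homDensity_map hU]

lemma homDensity_cliqueOn_sup_of_card_inter_eq_three [DecidableEq V]
    (hU : Measurable fun p : Ω × Ω => U s(p.1, p.2)) {s t : Finset V} (hs : #s = 3) (ht : #t = 3)
    (hst : #(s ∩ t) = 3) :
    homDensity P U (cliqueOn s ⊔ cliqueOn t) = homDensity P U triangle := by
  have h1 : s ∩ t = s := eq_of_subset_of_card_le inter_subset_left (hs.trans hst.symm).le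
  have h2 : s ∩ t = t := eq_of_subset_of_card_le inter_subset_right (ht.trans hst.symm).le
  rw [← h1.symm.trans h2, sup_idem, homDensity_cliqueOn hU hs, triangle]

/-- Two triangles on disjoint vertex sets are uncorrelated, so only the pairs sharing one, two or
three vertices contribute. -/
lemma sum_covariance_cliqueOn (hW : Measurable fun p : Ω × Ω => W s(p.1, p.2))
    {s : Finset V} (hs : #s = 3) :
    ∑ t ∈ powersetCard 3 univ, cov[fun ω => containInd (cliqueOn s) (kernelGraph W ω),
        fun ω => containInd (cliqueOn t) (kernelGraph W ω); kernelGraphLaw V P]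
      = 3 * ((Fintype.card V - 3).choose 2)
            * (homDensity P (edgeProb W) bowTie - homDensity P (edgeProb W) triangle ^ 2)
        + 3 * (Fintype.card V - 3 : ℕ)
            * (homDensity P (edgeProb W) diamond - homDensity P (edgeProb W) triangle ^ 2)
        + (homDensity P (edgeProb W) triangle - homDensity P (edgeProb W) triangle ^ 2) := by
  classical
  have hU := measurable_edgeProb hW
  have hcov : ∀ {t : Finset V}, #t = 3 →
      cov[fun ω => containInd (cliqueOn s) (kernelGraph W ω),
          fun ω => containInd (cliqueOn t) (kernelGraph W ω); kernelGraphLaw V P]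
        = homDensity P (edgeProb W) (cliqueOn s ⊔ cliqueOn t)
          - homDensity P (edgeProb W) triangle ^ 2 := fun ht => by
    rw [covariance_containInd hW, homDensity_cliqueOn hU hs, homDensity_cliqueOn hU ht, sq,
      triangle]
  have hmaps : ∀ t ∈ powersetCard 3 (univ : Finset V), #(s ∩ t) ∈ range 4 := fun t _ =>
    mem_range.2 (Nat.lt_succ_of_le (hs ▸ card_le_card inter_subset_left))
  rw [← sum_fiberwise_of_maps_to hmaps]
  simp only [sum_range_succ, range_zero, sum_empty, zero_add]
  rw [sum_filter_card_inter_eq (k := 0) (c := 0) (by lia) fun t ht hst => ?disjoint,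
    sum_filter_card_inter_eq (k := 1) (by lia) fun t ht hst => by
      rw [hcov ht, homDensity_cliqueOn_sup_of_card_inter_eq_one hU hs ht hst],
    sum_filter_card_inter_eq (k := 2) (by lia) fun t ht hst => by
      rw [hcov ht, homDensity_cliqueOn_sup_of_card_inter_eq_two hU hs ht hst],
    sum_filter_card_inter_eq (k := 3) (by lia) fun t ht hst => by
      rw [hcov ht, homDensity_cliqueOn_sup_of_card_inter_eq_three hU hs ht hst]]
  case disjoint =>
    rw [hcov ht, homDensity_cliqueOn_sup_of_disjoint hU
      (disjoint_iff_inter_eq_empty.2 (card_eq_zero.1 hst)), homDensity_cliqueOn hU hs,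
      homDensity_cliqueOn hU ht, ← sq, triangle, sub_self]
  simp [hs]

lemma variance_motifCount_triangle {n : ℕ} (hW : Measurable fun p : Ω × Ω => W s(p.1, p.2)) :
    Var[fun ω => motifCount triangle (kernelGraph W ω); kernelGraphLaw (Fin n) P]
      = 9 * n.descFactorial 5
            * (homDensity P (edgeProb W) bowTie - homDensity P (edgeProb W) triangle ^ 2)
        + 18 * n.descFactorial 4
            * (homDensity P (edgeProb W) diamond - homDensity P (edgeProb W) triangle ^ 2)
        + 6 * n.descFactorial 3
            * (homDensity P (edgeProb W) triangle - homDensity P (edgeProb W) triangle ^ 2) := by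
  have h3 : (n.descFactorial 3 : ℝ) = 6 * n.choose 3 :=
    mod_cast n.descFactorial_eq_factorial_mul_choose 3
  have h4 : (n.descFactorial 4 : ℝ) = n.descFactorial 3 * (n - 3 : ℕ) := by
    rw [Nat.descFactorial_succ, mul_comm, Nat.cast_mul]
  have h5 : (n.descFactorial 5 : ℝ) = 2 * n.descFactorial 3 * ((n - 3).choose 2) := by
    rw [← Nat.descFactorial_mul_descFactorial (show 3 ≤ 5 by lia),
      Nat.descFactorial_eq_factorial_mul_choose (n - 3)]
    push_cast
    rw [Nat.factorial_two]
    ring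
  simp only [motifCount_triangle, triangleCount, ncard_cliqueSet_eq_sum_containInd]
  rw [variance_const_mul, variance_fun_sum' fun s _ => memLp_containInd hW _ 2,
    sum_congr rfl fun s hs => sum_covariance_cliqueOn hW (mem_powersetCard.1 hs).2, sum_const,
    card_powersetCard, card_univ, Fintype.card_fin, nsmul_eq_mul, h5, h4, h3]
  ring

end TriangleVariance

section IteratedIntegrals

variable {Ω : Type*} [MeasurableSpace Ω]

lemma integrable_of_mem_Icc {P : Measure Ω} [IsFiniteMeasure P] {F : Ω → ℝ} (hF : Measurable F)
    (hF01 : ∀ x, F x ∈ Set.Icc 0 1) : Integrable F P :=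
  Integrable.of_bound hF.aestronglyMeasurable 1 <| ae_of_all _ fun x => by
    rw [Real.norm_of_nonneg (hF01 x).1]
    exact (hF01 x).2

lemma measurable_fin_cons {k : ℕ} (x : Ω) :
    Measurable fun h : Fin k → Ω => (Fin.cons x h : Fin (k + 1) → Ω) := by
  refine measurable_pi_lambda _ fun i => Fin.cases ?_ (fun j => ?_) i
  · exact measurable_const
  · exact measurable_pi_apply j

variable {P : Measure Ω} [IsProbabilityMeasure P]

lemma integral_pi_succ {k : ℕ} {F : (Fin (k + 1) → Ω) → ℝ} (hF : Measurable F)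
    (hF01 : ∀ h, F h ∈ Set.Icc 0 1) :
    ∫ h, F h ∂(Measure.pi fun _ => P)
      = ∫ x, ∫ h, F (Fin.cons x h) ∂(Measure.pi fun _ => P) ∂P := by
  have he := measurePreserving_piFinSuccAbove (fun _ : Fin (k + 1) => P) 0
  set e := MeasurableEquiv.piFinSuccAbove (fun _ : Fin (k + 1) => Ω) 0
  have hcons : ∀ p : Ω × (Fin k → Ω), e.symm p = Fin.cons p.1 p.2 := fun p => by
    simp [e, MeasurableEquiv.piFinSuccAbove, Fin.consEquiv]
  have hint : Integrable (fun p => F (e.symm p)) (P.prod (Measure.pi fun _ : Fin k => P)) :=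
    integrable_of_mem_Icc (hF.comp e.symm.measurable) fun _ => hF01 _
  rw [← he.symm.integral_comp', integral_prod _ hint]
  simp only [hcons]

lemma integral_pi_two {F : (Fin 2 → Ω) → ℝ} (hF : Measurable F)
    (hF01 : ∀ h, F h ∈ Set.Icc 0 1) :
    ∫ h, F h ∂(Measure.pi fun _ => P) = ∫ x, ∫ y, F ![x, y] ∂P ∂P := by
  have hempty : ∀ G : (Fin 0 → Ω) → ℝ, ∫ h, G h ∂(Measure.pi fun _ => P) = G ![] := fun G => by
    rw [Measure.pi_of_empty, integral_dirac]
    exact congrArg G (Subsingleton.elim _ _)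
  rw [integral_pi_succ hF hF01]
  congr! 2 with x
  rw [integral_pi_succ (F := fun h => F (Fin.cons x h)) (hF.comp (measurable_fin_cons x))
    fun _ => hF01 _]
  simp only [hempty]
  rfl

lemma integral_pi_three {F : (Fin 3 → Ω) → ℝ} (hF : Measurable F)
    (hF01 : ∀ h, F h ∈ Set.Icc 0 1) :
    ∫ h, F h ∂(Measure.pi fun _ => P) = ∫ x, ∫ y, ∫ z, F ![x, y, z] ∂P ∂P ∂P := by
  rw [integral_pi_succ hF hF01]
  congr! 2 with x
  exact integral_pi_two (hF.comp (measurable_fin_cons x)) fun _ => hF01 _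

lemma integral_pi_five {F : (Fin 5 → Ω) → ℝ} (hF : Measurable F)
    (hF01 : ∀ h, F h ∈ Set.Icc 0 1) :
    ∫ h, F h ∂(Measure.pi fun _ => P)
      = ∫ x, ∫ y, ∫ z, ∫ v, ∫ w, F ![x, y, z, v, w] ∂P ∂P ∂P ∂P ∂P := by
  rw [integral_pi_succ hF hF01]
  congr! 2 with x
  rw [integral_pi_succ (F := fun h => F (Fin.cons x h)) (hF.comp (measurable_fin_cons x))
    fun _ => hF01 _]
  congr! 2 with y
  exact integral_pi_three ((hF.comp (measurable_fin_cons x)).comp (measurable_fin_cons y))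
    fun _ => hF01 _

end IteratedIntegrals

section RootedTriangle

variable {Ω : Type*} [MeasurableSpace Ω]

/-- The probability, in the random graph with edge probabilities `U`, that a vertex at `x` forms a
triangle with two other vertices whose positions are independent with law `P`. -/
noncomputable def rootedTriangle (P : Measure Ω) (U : Sym2 Ω → ℝ) (x : Ω) : ℝ :=
  ∫ p, U s(x, p.1) * U s(x, p.2) * U s(p.1, p.2) ∂(P.prod P)

variable {P : Measure Ω} {U : Sym2 Ω → ℝ} {x : Ω}

lemma mul_mul_mem_Icc {a b c : ℝ} (ha : a ∈ Set.Icc 0 1) (hb : b ∈ Set.Icc 0 1)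
    (hc : c ∈ Set.Icc 0 1) : a * b * c ∈ Set.Icc 0 1 :=
  unitInterval.mul_mem (unitInterval.mul_mem ha hb) hc

lemma measurable_rootedTriangle_integrand (hU : Measurable fun p : Ω × Ω => U s(p.1, p.2)) :
    Measurable fun q : Ω × Ω × Ω => U s(q.1, q.2.1) * U s(q.1, q.2.2) * U s(q.2.1, q.2.2) := by
  have h1 : Measurable fun q : Ω × Ω × Ω => (q.1, q.2.1) := by fun_prop
  have h2 : Measurable fun q : Ω × Ω × Ω => (q.1, q.2.2) := by fun_prop
  have h3 : Measurable fun q : Ω × Ω × Ω => (q.2.1, q.2.2) := by fun_prop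
  exact ((hU.comp h1).mul (hU.comp h2)).mul (hU.comp h3)

variable [IsProbabilityMeasure P]

lemma integrable_rootedTriangle_integrand (hU : Measurable fun p : Ω × Ω => U s(p.1, p.2))
    (hU01 : ∀ e, U e ∈ Set.Icc 0 1) (x : Ω) :
    Integrable (fun p : Ω × Ω => U s(x, p.1) * U s(x, p.2) * U s(p.1, p.2)) (P.prod P) :=
  integrable_of_mem_Icc ((measurable_rootedTriangle_integrand hU).comp measurable_prodMk_left)
    fun _ => mul_mul_mem_Icc (hU01 _) (hU01 _) (hU01 _)

lemma rootedTriangle_mem_Icc (hU : Measurable fun p : Ω × Ω => U s(p.1, p.2))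
    (hU01 : ∀ e, U e ∈ Set.Icc 0 1) (x : Ω) : rootedTriangle P U x ∈ Set.Icc 0 1 :=
  (convex_Icc 0 1).integral_mem isClosed_Icc
    (ae_of_all _ fun _ => mul_mul_mem_Icc (hU01 _) (hU01 _) (hU01 _))
    (integrable_rootedTriangle_integrand hU hU01 x)

lemma measurable_rootedTriangle (hU : Measurable fun p : Ω × Ω => U s(p.1, p.2)) :
    Measurable (rootedTriangle P U) :=
  (measurable_rootedTriangle_integrand hU).stronglyMeasurable.integral_prod_right'.measurable

lemma rootedTriangle_eq_integral_integral (hU : Measurable fun p : Ω × Ω => U s(p.1, p.2))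
    (hU01 : ∀ e, U e ∈ Set.Icc 0 1) (x : Ω) :
    rootedTriangle P U x = ∫ y, ∫ z, U s(x, y) * U s(x, z) * U s(y, z) ∂P ∂P :=
  integral_prod _ (integrable_rootedTriangle_integrand hU hU01 x)

lemma homDensity_triangle (hU : Measurable fun p : Ω × Ω => U s(p.1, p.2))
    (hU01 : ∀ e, U e ∈ Set.Icc 0 1) :
    homDensity P U triangle = ∫ x, rootedTriangle P U x ∂P := by
  have htriangle : triangle
      = SimpleGraph.fromEdgeSet ((({s(0, 1), s(0, 2), s(1, 2)} : Finset (Sym2 (Fin 3))) :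
          Set (Sym2 (Fin 3)))) := by
    ext a b
    simp only [triangle, SimpleGraph.top_adj, SimpleGraph.fromEdgeSet_adj, mem_coe]
    decide +revert
  rw [homDensity, integral_pi_three (measurable_edgeWeight hU _) (edgeWeight_mem_Icc hU01 _)]
  simp only [rootedTriangle_eq_integral_integral hU hU01, htriangle]
  congr! 6 with x y z
  rw [edgeWeight_fromEdgeSet (by decide), prod_insert (by decide), prod_insert (by decide),
    prod_singleton, ← mul_assoc]
  rfl

/-- Given the position of the centre of the bow-tie, its two triangles are independent. -/
lemma homDensity_bowTie (hU : Measurable fun p : Ω × Ω => U s(p.1, p.2))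
    (hU01 : ∀ e, U e ∈ Set.Icc 0 1) :
    homDensity P U bowTie = ∫ x, rootedTriangle P U x ^ 2 ∂P := by
  have hbowTie : bowTie = SimpleGraph.fromEdgeSet ((({s(0, 1), s(0, 2), s(1, 2), s(0, 3), s(0, 4),
      s(3, 4)} : Finset (Sym2 (Fin 5))) : Set (Sym2 (Fin 5)))) := by
    simp [bowTie]
  have hweight : ∀ x y z v w : Ω, edgeWeight U bowTie ![x, y, z, v, w]
      = U s(x, y) * U s(x, z) * U s(y, z) * (U s(x, v) * U s(x, w) * U s(v, w)) := by
    intro x y z v w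
    rw [hbowTie, edgeWeight_fromEdgeSet (by decide)]
    iterate 5 rw [prod_insert (by decide)]
    simp only [prod_singleton, ← mul_assoc]
    rfl
  rw [homDensity, integral_pi_five (measurable_edgeWeight hU _) (edgeWeight_mem_Icc hU01 _)]
  simp only [hweight, integral_const_mul, integral_mul_const, sq,
    rootedTriangle_eq_integral_integral hU hU01]

lemma rootedTriangle_le_mul_sq (hU : Measurable fun p : Ω × Ω => U s(p.1, p.2))
    (hU01 : ∀ e, U e ∈ Set.Icc 0 1) {f : Ω → ℝ} {c : ℝ}
    (hint : Integrable (fun y => f y * U s(x, y)) P)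
    (hle : ∀ y z, U s(y, z) ≤ c * (f y * f z)) :
    rootedTriangle P U x ≤ c * (∫ y, f y * U s(x, y) ∂P) ^ 2 :=
  calc rootedTriangle P U x
      ≤ ∫ p, c * ((f p.1 * U s(x, p.1)) * (f p.2 * U s(x, p.2))) ∂(P.prod P) := by
        refine integral_mono (integrable_rootedTriangle_integrand hU hU01 x)
          ((hint.mul_prod hint).const_mul c) fun p => ?_
        exact (mul_le_mul_of_nonneg_left (hle _ _)
          (mul_nonneg (hU01 _).1 (hU01 _).1)).trans_eq (by ring)
    _ = c * (∫ y, f y * U s(x, y) ∂P) ^ 2 := by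
        rw [integral_const_mul, integral_prod_mul (fun y => f y * U s(x, y))
          (fun y => f y * U s(x, y)), sq]

lemma mul_sq_measureReal_le_rootedTriangle (hU : Measurable fun p : Ω × Ω => U s(p.1, p.2))
    (hU01 : ∀ e, U e ∈ Set.Icc 0 1) {S : Set Ω} (hS : MeasurableSet S) {b : ℝ}
    (hx : ∀ y ∈ S, 1 ≤ U s(x, y)) (hb : ∀ y ∈ S, ∀ z ∈ S, b ≤ U s(y, z)) :
    b * P.real S ^ 2 ≤ rootedTriangle P U x := by
  have hint := integrable_rootedTriangle_integrand (P := P) hU hU01 x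
  calc b * P.real S ^ 2 = ∫ _ in S ×ˢ S, b ∂(P.prod P) := by
        rw [setIntegral_const, measureReal_prod_prod, smul_eq_mul]
        ring
    _ ≤ ∫ p in S ×ˢ S, U s(x, p.1) * U s(x, p.2) * U s(p.1, p.2) ∂(P.prod P) := by
        refine setIntegral_mono_on (integrable_const b).integrableOn hint.integrableOn
          (hS.prod hS) fun p hp => (hb _ hp.1 _ hp.2).trans ?_
        exact le_mul_of_one_le_left (hU01 _).1 (one_le_mul_of_one_le_of_one_le (hx _ hp.1)
          (hx _ hp.2))
    _ ≤ rootedTriangle P U x := setIntegral_le_integral hint <| ae_of_all _ fun _ =>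
        (mul_mul_mem_Icc (hU01 _) (hU01 _) (hU01 _)).1

end RootedTriangle

section DegreeBound

variable {V V' Ω : Type*} [Fintype V] [Fintype V']

open Classical in
lemma prod_edgeFinset_mul_map (H : SimpleGraph V) (g : V → ℝ) :
    ∏ e ∈ H.edgeFinset, (e.map g).mul = ∏ v, g v ^ H.degree v := by
  have hedge : ∀ e ∈ H.edgeFinset, (e.map g).mul = ∏ v ∈ e.toFinset, g v := fun e => by
    induction e with
    | _ a b =>
      intro hab
      rw [Sym2.toFinset_mk_eq, prod_pair (H.ne_of_adj (SimpleGraph.mem_edgeFinset.1 hab))]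
      rfl
  rw [prod_congr rfl hedge, prod_comm' (t' := univ) (s' := fun v => H.incidenceFinset v)
    fun e v => by simp [SimpleGraph.incidenceFinset_eq_filter]]
  simp only [prod_const, SimpleGraph.card_incidenceFinset_eq_degree]

open Classical in
lemma edgeWeight_le_of_le_mul {U : Sym2 Ω → ℝ} (hU : ∀ e, 0 ≤ U e) {c : ℝ} {f : Ω → ℝ}
    (hle : ∀ x y, U s(x, y) ≤ c * (f x * f y)) (H : SimpleGraph V) (x : V → Ω) :
    edgeWeight U H x ≤ c ^ #H.edgeFinset * ∏ v, f (x v) ^ H.degree v := by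
  rw [← prod_edgeFinset_mul_map H fun v => f (x v), ← prod_const, ← prod_mul_distrib]
  refine prod_le_prod (fun _ _ => hU _) fun e _ => ?_
  induction e with
  | _ a b => exact hle _ _

variable [MeasurableSpace Ω] {P : Measure Ω} [IsProbabilityMeasure P] {U : Sym2 Ω → ℝ}

lemma integrable_edgeWeight (hU : Measurable fun p : Ω × Ω => U s(p.1, p.2))
    (hU01 : ∀ e, U e ∈ Set.Icc 0 1) (H : SimpleGraph V) :
    Integrable (edgeWeight U H) (Measure.pi fun _ => P) :=
  integrable_of_mem_Icc (measurable_edgeWeight hU H) (edgeWeight_mem_Icc hU01 H)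

lemma homDensity_antitone (hU : Measurable fun p : Ω × Ω => U s(p.1, p.2))
    (hU01 : ∀ e, U e ∈ Set.Icc 0 1) : Antitone (homDensity P U : SimpleGraph V → ℝ) := by
  classical
  intro H H' hle
  refine integral_mono (integrable_edgeWeight hU hU01 H') (integrable_edgeWeight hU hU01 H)
    fun x => ?_
  exact prod_le_prod_of_subset_of_le_one (SimpleGraph.edgeFinset_mono hle)
    (fun _ _ => (hU01 _).1) fun _ _ _ => (hU01 _).2

open Classical in
lemma homDensity_le_of_le_mul (hU : Measurable fun p : Ω × Ω => U s(p.1, p.2))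
    (hU01 : ∀ e, U e ∈ Set.Icc 0 1) {c : ℝ} {f : Ω → ℝ}
    (hle : ∀ x y, U s(x, y) ≤ c * (f x * f y)) (H : SimpleGraph V)
    (hint : ∀ v, Integrable (fun x => f x ^ H.degree v) P) :
    homDensity P U H ≤ c ^ #H.edgeFinset * ∏ v, ∫ x, f x ^ H.degree v ∂P := by
  rw [← integral_fintype_prod_eq_prod (f := fun v x => f x ^ H.degree v), ← integral_const_mul]
  exact integral_mono (integrable_edgeWeight hU hU01 H)
    ((Integrable.fintype_prod hint).const_mul _)
    (edgeWeight_le_of_le_mul (fun e => (hU01 e).1) hle H)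

/-- The diamond contains a 4-cycle, all of whose vertices have degree 2. -/
lemma homDensity_diamond_le (hU : Measurable fun p : Ω × Ω => U s(p.1, p.2))
    (hU01 : ∀ e, U e ∈ Set.Icc 0 1) {c : ℝ} {f : Ω → ℝ}
    (hle : ∀ x y, U s(x, y) ≤ c * (f x * f y)) (hint : Integrable (fun x => f x ^ 2) P) :
    homDensity P U diamond ≤ (c * ∫ x, f x ^ 2 ∂P) ^ 4 := by
  classical
  have hdeg : ∀ v [Fintype ((SimpleGraph.cycleGraph 4).neighborSet v)],
      (SimpleGraph.cycleGraph 4).degree v = 2 := fun v _ => by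
    convert SimpleGraph.cycleGraph_degree_three_le (n := 1)
  have hcard : #(SimpleGraph.cycleGraph 4).edgeFinset = 4 := by decide
  have hcycle :
      (SimpleGraph.cycleGraph 4).map (Equiv.swap (1 : Fin 4) 2).toEmbedding ≤ diamond := by
    rw [SimpleGraph.map_le_iff_le_comap]
    intro a b
    simp only [SimpleGraph.comap_adj, diamond, SimpleGraph.fromEdgeSet_adj, Set.mem_insert_iff,
      Set.mem_singleton_iff]
    decide +revert
  calc homDensity P U diamond
      ≤ homDensity P U (SimpleGraph.cycleGraph 4) := by
        rw [← homDensity_map hU (Equiv.swap (1 : Fin 4) 2).toEmbedding (SimpleGraph.cycleGraph 4)]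
        exact homDensity_antitone hU hU01 hcycle
    _ ≤ (c * ∫ x, f x ^ 2 ∂P) ^ 4 := by
        refine (homDensity_le_of_le_mul hU hU01 hle _ fun v => ?_).trans_eq ?_
        · rwa [hdeg]
        · simp only [hdeg, prod_const, card_univ, Fintype.card_fin, mul_pow]
          congr 2
          convert hcard

end DegreeBound

section Pareto

variable {τ hmin : ℝ}

/-- The normalising constant `C` of the density `C * h ^ (-τ)` of a hidden variable. -/
noncomputable def densityConst (τ hmin : ℝ) : ℝ := (τ - 1) * hmin ^ (τ - 1)

lemma densityConst_pos (hτ : 1 < τ) (hhmin : 0 < hmin) : 0 < densityConst τ hmin :=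
  mul_pos (by linarith) (Real.rpow_pos_of_pos hhmin _)

lemma isProbabilityMeasure_weightLaw (hτ : 1 < τ) (hhmin : 0 < hmin) :
    IsProbabilityMeasure (weightLaw τ hmin) :=
  isProbabilityMeasure_paretoMeasure hhmin (by linarith)

lemma weightLaw_eq_withDensity :
    weightLaw τ hmin = ((volume : Measure ℝ).restrict (Set.Ioi hmin)).withDensity
      fun x => ENNReal.ofReal (densityConst τ hmin * x ^ (-τ)) := by
  rw [Measure.restrict_congr_set Ioi_ae_eq_Ici, ← withDensity_indicator measurableSet_Ici,
    weightLaw, paretoMeasure]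
  congr 1
  ext x
  rw [paretoPDF_eq, Set.indicator_apply]
  simp only [Set.mem_Ici, sub_add_cancel, densityConst]
  split_ifs <;> simp

lemma ae_weightLaw_gt : ∀ᵐ x ∂(weightLaw τ hmin), hmin < x := by
  rw [weightLaw_eq_withDensity]
  exact (withDensity_absolutelyContinuous _ _).ae_le (ae_restrict_mem measurableSet_Ioi)

lemma measurable_density :
    Measurable fun x : ℝ => ENNReal.ofReal (densityConst τ hmin * x ^ (-τ)) := by
  fun_prop

lemma density_smul_rpow (hτ : 1 < τ) (hhmin : 0 < hmin) (a : ℝ) {x : ℝ} (hx : hmin < x) :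
    (ENNReal.ofReal (densityConst τ hmin * x ^ (-τ))).toReal • x ^ a
      = densityConst τ hmin * x ^ (a - τ) := by
  have hx0 : 0 < x := hhmin.trans hx
  rw [ENNReal.toReal_ofReal (mul_nonneg (densityConst_pos hτ hhmin).le
    (Real.rpow_nonneg hx0.le _)), smul_eq_mul, mul_assoc, ← Real.rpow_add hx0, neg_add_eq_sub]

lemma integrableOn_rpow_weightLaw (hτ : 1 < τ) (hhmin : 0 < hmin) (a : ℝ) {s : Set ℝ}
    (hs : MeasurableSet s) (h : IntegrableOn (fun x => x ^ (a - τ)) (s ∩ Set.Ioi hmin)) :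
    IntegrableOn (fun x => x ^ a) s (weightLaw τ hmin) := by
  rw [IntegrableOn, weightLaw_eq_withDensity, restrict_withDensity hs,
    Measure.restrict_restrict hs,
    integrable_withDensity_iff_integrable_smul' measurable_density (by simp)]
  exact IntegrableOn.congr_fun (Integrable.const_mul h (densityConst τ hmin))
    (fun x hx => (density_smul_rpow hτ hhmin a hx.2).symm) (hs.inter measurableSet_Ioi)

lemma setIntegral_rpow_weightLaw (hτ : 1 < τ) (hhmin : 0 < hmin) (a : ℝ) {s : Set ℝ}
    (hs : MeasurableSet s) :
    ∫ x in s, x ^ a ∂(weightLaw τ hmin)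
      = densityConst τ hmin * ∫ x in s ∩ Set.Ioi hmin, x ^ (a - τ) := by
  rw [weightLaw_eq_withDensity, restrict_withDensity hs, Measure.restrict_restrict hs,
    integral_withDensity_eq_integral_toReal_smul measurable_density (by simp),
    ← integral_const_mul]
  exact setIntegral_congr_fun (hs.inter measurableSet_Ioi)
    fun x hx => density_smul_rpow hτ hhmin a hx.2

lemma integrable_rpow_weightLaw (hτ : 1 < τ) (hhmin : 0 < hmin) {a : ℝ} (ha : a < τ - 1) :
    Integrable (fun x => x ^ a) (weightLaw τ hmin) := by
  refine integrableOn_univ.1 (integrableOn_rpow_weightLaw hτ hhmin a MeasurableSet.univ ?_)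
  rw [Set.univ_inter]
  exact integrableOn_Ioi_rpow_of_lt (by linarith) hhmin

lemma setIntegral_weightLaw_le_of_le_rpow (hτ : 1 < τ) (hhmin : 0 < hmin) {a A : ℝ}
    {s t : Set ℝ} {F : ℝ → ℝ} (hs : MeasurableSet s) (ht : MeasurableSet t)
    (hst : s ∩ Set.Ioi hmin ⊆ t) (ht0 : t ⊆ Set.Ioi 0) (hint : IntegrableOn (· ^ (a - τ)) t)
    (hA : 0 ≤ A) (hF : ∀ x, 0 ≤ F x) (hle : ∀ x ∈ t, F x ≤ A * x ^ a) :
    ∫ x in s, F x ∂(weightLaw τ hmin)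
      ≤ A * (densityConst τ hmin * ∫ x in t, x ^ (a - τ)) := by
  have hpow : IntegrableOn (fun x => x ^ a) s (weightLaw τ hmin) :=
    integrableOn_rpow_weightLaw hτ hhmin a hs (hint.mono_set hst)
  have hmem : ∀ᵐ x ∂(weightLaw τ hmin).restrict s, x ∈ t := by
    filter_upwards [ae_restrict_mem hs, ae_restrict_of_ae ae_weightLaw_gt] with x hxs hx
    exact hst ⟨hxs, hx⟩
  calc ∫ x in s, F x ∂(weightLaw τ hmin)
      ≤ ∫ x in s, A * x ^ a ∂(weightLaw τ hmin) :=
        integral_mono_of_nonneg (ae_of_all _ hF) (hpow.const_mul A) (hmem.mono hle)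
    _ = A * (densityConst τ hmin * ∫ x in s ∩ Set.Ioi hmin, x ^ (a - τ)) := by
        rw [integral_const_mul, setIntegral_rpow_weightLaw hτ hhmin a hs]
    _ ≤ A * (densityConst τ hmin * ∫ x in t, x ^ (a - τ)) := by
        refine mul_le_mul_of_nonneg_left (mul_le_mul_of_nonneg_left ?_
          (densityConst_pos hτ hhmin).le) hA
        exact setIntegral_mono_set hint ((ae_restrict_mem ht).mono fun x hx =>
          Real.rpow_nonneg (ht0 hx).le _) hst.eventuallyLE

lemma setIntegral_Ioi_weightLaw_le_of_le_rpow (hτ : 1 < τ) (hhmin : 0 < hmin) {a A t : ℝ}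
    (ha : a < τ - 1) (ht : 0 < t) {F : ℝ → ℝ} (hA : 0 ≤ A) (hF : ∀ x, 0 ≤ F x)
    (hle : ∀ x > t, F x ≤ A * x ^ a) :
    ∫ x in Set.Ioi t, F x ∂(weightLaw τ hmin)
      ≤ densityConst τ hmin / (τ - 1 - a) * (A * t ^ (a - (τ - 1))) := by
  refine (setIntegral_weightLaw_le_of_le_rpow hτ hhmin measurableSet_Ioi measurableSet_Ioi
    Set.inter_subset_left (Set.Ioi_subset_Ioi ht.le)
    (integrableOn_Ioi_rpow_of_lt (by linarith) ht) hA hF hle).trans_eq ?_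
  rw [integral_Ioi_rpow_of_lt (by linarith) ht, show a - τ + 1 = a - (τ - 1) by ring,
    ← neg_sub (τ - 1) a, neg_div_neg_eq]
  ring

lemma setIntegral_Iic_weightLaw_le_of_le_rpow (hτ : 1 < τ) (hhmin : 0 < hmin) {a A t : ℝ}
    (ha : τ - 1 < a) (ht : 0 ≤ t) {F : ℝ → ℝ} (hA : 0 ≤ A) (hF : ∀ x, 0 ≤ F x)
    (hle : ∀ x ∈ Set.Ioc 0 t, F x ≤ A * x ^ a) :
    ∫ x in Set.Iic t, F x ∂(weightLaw τ hmin)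
      ≤ densityConst τ hmin / (a - (τ - 1)) * (A * t ^ (a - (τ - 1))) := by
  have hint : IntegrableOn (fun x : ℝ => x ^ (a - τ)) (Set.Ioc 0 t) :=
    (intervalIntegrable_iff_integrableOn_Ioc_of_le ht).1
      (intervalIntegral.intervalIntegrable_rpow' (by linarith))
  refine (setIntegral_weightLaw_le_of_le_rpow hτ hhmin measurableSet_Iic measurableSet_Ioc
    (fun x hx => ⟨hhmin.trans hx.2, hx.1⟩) (fun x hx => hx.1) hint hA hF hle).trans_eq ?_
  rw [← intervalIntegral.integral_of_le ht, integral_rpow (Or.inl (by linarith)),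
    show a - τ + 1 = a - (τ - 1) by ring, Real.zero_rpow (by linarith), sub_zero]
  ring

lemma setIntegral_Ioc_rpow_weightLaw (hτ : 1 < τ) (hhmin : 0 < hmin) (a : ℝ) {b c : ℝ}
    (hb : hmin ≤ b) (hbc : b ≤ c) :
    ∫ x in Set.Ioc b c, x ^ a ∂(weightLaw τ hmin)
      = densityConst τ hmin * ∫ x in b..c, x ^ (a - τ) := by
  rw [setIntegral_rpow_weightLaw hτ hhmin a measurableSet_Ioc, Set.inter_eq_left.2,
    intervalIntegral.integral_of_le hbc]
  exact fun x hx => hb.trans_lt hx.1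

lemma integrableOn_Ioc_rpow_weightLaw (hτ : 1 < τ) (hhmin : 0 < hmin) (a : ℝ) {b : ℝ}
    (hb : 0 < b) (c : ℝ) : IntegrableOn (fun x => x ^ a) (Set.Ioc b c) (weightLaw τ hmin) := by
  refine integrableOn_rpow_weightLaw hτ hhmin a measurableSet_Ioc (IntegrableOn.mono_set
    (ContinuousOn.integrableOn_Icc fun x hx => ?_)
    (Set.inter_subset_left.trans Set.Ioc_subset_Icc_self))
  exact (Real.continuousAt_rpow_const _ _
    (Or.inl (hb.trans_le hx.1).ne')).continuousWithinAt

lemma weightLaw_real_Ioi (hτ : 1 < τ) (hhmin : 0 < hmin) {t : ℝ} (ht : hmin ≤ t) :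
    (weightLaw τ hmin).real (Set.Ioi t) = (hmin / t) ^ (τ - 1) := by
  have ht0 : 0 < t := hhmin.trans_le ht
  have hτ0 : τ - 1 ≠ 0 := by linarith
  calc (weightLaw τ hmin).real (Set.Ioi t)
      = ∫ x in Set.Ioi t, x ^ (0 : ℝ) ∂(weightLaw τ hmin) := by
        simp only [Real.rpow_zero, setIntegral_const, smul_eq_mul, mul_one]
    _ = densityConst τ hmin * (-t ^ (-(τ - 1)) / -(τ - 1)) := by
        rw [setIntegral_rpow_weightLaw hτ hhmin 0 measurableSet_Ioi,
          Set.inter_eq_left.2 (Set.Ioi_subset_Ioi ht),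
          integral_Ioi_rpow_of_lt (by linarith) ht0, show 0 - τ + 1 = -(τ - 1) by ring]
    _ = (hmin / t) ^ (τ - 1) := by
        rw [densityConst, Real.div_rpow hhmin.le ht0.le, Real.rpow_neg ht0.le]
        field_simp

lemma integrable_id_weightLaw (hτ : 2 < τ) (hhmin : 0 < hmin) :
    Integrable (fun x => x) (weightLaw τ hmin) := by
  simpa only [Real.rpow_one] using
    integrable_rpow_weightLaw (by linarith) hhmin (show 1 < τ - 1 by linarith)

lemma meanWeight_pos (hτ : 2 < τ) (hhmin : 0 < hmin) : 0 < meanWeight τ hmin := by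
  have := isProbabilityMeasure_weightLaw (show 1 < τ by linarith) hhmin
  calc 0 < ∫ _, hmin ∂(weightLaw τ hmin) := by
        rwa [integral_const, probReal_univ, one_smul]
    _ ≤ meanWeight τ hmin := integral_mono_ae (integrable_const _)
        (integrable_id_weightLaw hτ hhmin) (ae_weightLaw_gt.mono fun _ hx => hx.le)

end Pareto

section ConnectionKernel

/-- The connection kernel `min (x y / N) 1` of the hidden-variable model, as a function of the pair
of weights `x`, `y`, with a real parameter `N` in place of `μ n`. -/
noncomputable def connKernel (N : ℝ) (e : Sym2 ℝ) : ℝ := min (e.mul / N) 1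

/-- The conditional probability that two vertices are joined, given their weights. Weights are
positive almost surely, where this agrees with `connKernel`. -/
noncomputable abbrev joinProb (N : ℝ) : Sym2 ℝ → ℝ := edgeProb (connKernel N)

variable {N x y : ℝ}

lemma connKernel_mk (N x y : ℝ) : connKernel N s(x, y) = min (x * y / N) 1 := rfl

lemma measurable_connKernel (N : ℝ) : Measurable fun p : ℝ × ℝ => connKernel N s(p.1, p.2) := by
  simp only [connKernel_mk]
  fun_prop

lemma measurable_joinProb (N : ℝ) : Measurable fun p : ℝ × ℝ => joinProb N s(p.1, p.2) :=
  measurable_edgeProb (measurable_connKernel N)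

lemma joinProb_le_mul (hN : 0 ≤ N) (hx : 0 ≤ x) (hy : 0 ≤ y) :
    joinProb N s(x, y) ≤ x / N * y := by
  rw [joinProb, edgeProb, connKernel_mk, min_eq_left (min_le_right _ _), div_mul_eq_mul_div]
  exact max_le (by positivity) (min_le_left _ _)

lemma le_joinProb {b : ℝ} (h1 : b ≤ 1) (h : b ≤ x * y / N) : b ≤ joinProb N s(x, y) := by
  rw [joinProb, edgeProb, connKernel_mk, min_eq_left (min_le_right _ _)]
  exact (le_min h h1).trans (le_max_right _ _)

/-- Interpolates between the bounds `1` and `x y / N`. -/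
lemma joinProb_le_rpow {s : ℝ} (hs : s ∈ Set.Icc 0 1) (hN : 0 < N) (x y : ℝ) :
    joinProb N s(x, y) ≤ N ^ (-s) * (|x| ^ s * |y| ^ s) := by
  have hle : joinProb N s(x, y) ≤ |x| * |y| / N := by
    rw [joinProb, edgeProb, connKernel_mk, min_eq_left (min_le_right _ _), ← abs_mul]
    refine max_le (by positivity) ((min_le_left _ _).trans ?_)
    gcongr
    exact le_abs_self _
  have h01 : joinProb N s(x, y) ∈ Set.Icc 0 1 := edgeProb_mem_Icc _
  calc joinProb N s(x, y) ≤ joinProb N s(x, y) ^ s := by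
        simpa only [Real.rpow_one] using Real.rpow_le_rpow_of_exponent_ge' h01.1 h01.2 hs.1 hs.2
    _ ≤ (|x| * |y| / N) ^ s := Real.rpow_le_rpow h01.1 hle hs.1
    _ = N ^ (-s) * (|x| ^ s * |y| ^ s) := by
        rw [Real.div_rpow (by positivity) hN.le, Real.mul_rpow (abs_nonneg _) (abs_nonneg _),
          Real.rpow_neg hN.le, div_eq_inv_mul]

end ConnectionKernel

section RootedTriangleBounds

variable {τ hmin : ℝ}

/-- The probability that a vertex of weight `x` forms a triangle with two other given vertices. -/
noncomputable abbrev triangleProb (τ hmin N x : ℝ) : ℝ :=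
  rootedTriangle (weightLaw τ hmin) (joinProb N) x

lemma integrable_abs_rpow_weightLaw (hτ : 1 < τ) (hhmin : 0 < hmin) {s : ℝ} (hs : s < τ - 1) :
    Integrable (fun x => |x| ^ s) (weightLaw τ hmin) :=
  (integrable_rpow_weightLaw hτ hhmin hs).congr <| ae_weightLaw_gt.mono fun x hx => by
    simp only [abs_of_pos (hhmin.trans hx)]

lemma integrable_abs_rpow_mul_joinProb (hτ : 1 < τ) (hhmin : 0 < hmin) {s : ℝ} (hs : s < τ - 1)
    (N x : ℝ) : Integrable (fun y => |y| ^ s * joinProb N s(x, y)) (weightLaw τ hmin) :=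
  (integrable_abs_rpow_weightLaw hτ hhmin hs).mul_bdd
    ((measurable_joinProb N).comp measurable_prodMk_left).aestronglyMeasurable
    (c := 1) (ae_of_all _ fun y => by
      have h01 : joinProb N s(x, y) ∈ Set.Icc 0 1 := edgeProb_mem_Icc _
      rw [Real.norm_of_nonneg h01.1]
      exact h01.2)

/-- The integral is split at `N / x`, where the connection probability reaches `1`. -/
lemma exists_integral_rpow_mul_joinProb_le (hτ : 1 < τ) (hhmin : 0 < hmin) {s : ℝ}
    (hs : τ - 2 < s) (hs' : s < τ - 1) :
    ∃ K, ∀ N > 0, ∀ x > 0, ∫ y, |y| ^ s * joinProb N s(x, y) ∂(weightLaw τ hmin)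
      ≤ K * (x / N) ^ (τ - 1 - s) := by
  refine ⟨densityConst τ hmin / (s + 1 - (τ - 1)) + densityConst τ hmin / (τ - 1 - s),
    fun N hN x hx => ?_⟩
  have hr : 0 < x / N := by positivity
  have h0 : ∀ y, 0 ≤ |y| ^ s * joinProb N s(x, y) := fun y =>
    mul_nonneg (by positivity) (edgeProb_mem_Icc _).1
  have hsmall : ∀ y ∈ Set.Ioc 0 (x / N)⁻¹,
      |y| ^ s * joinProb N s(x, y) ≤ x / N * y ^ (s + 1) := fun y hy => by
    rw [abs_of_pos hy.1, Real.rpow_add_one hy.1.ne', mul_left_comm]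
    exact mul_le_mul_of_nonneg_left (joinProb_le_mul hN.le hx.le hy.1.le)
      (Real.rpow_nonneg hy.1.le _)
  have hlarge : ∀ y > (x / N)⁻¹, |y| ^ s * joinProb N s(x, y) ≤ 1 * y ^ s := fun y hy => by
    rw [abs_of_pos ((inv_pos.2 hr).trans hy), mul_comm]
    exact mul_le_mul_of_nonneg_right (edgeProb_mem_Icc _).2
      (Real.rpow_nonneg ((inv_pos.2 hr).trans hy).le _)
  rw [← integral_add_compl measurableSet_Iic (integrable_abs_rpow_mul_joinProb hτ hhmin hs' N x),
    Set.compl_Iic]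
  refine (add_le_add
    (setIntegral_Iic_weightLaw_le_of_le_rpow hτ hhmin (by linarith) (inv_pos.2 hr).le hr.le h0
      hsmall)
    (setIntegral_Ioi_weightLaw_le_of_le_rpow hτ hhmin hs' (inv_pos.2 hr) zero_le_one h0
      hlarge)).trans_eq ?_
  rw [Real.inv_rpow hr.le, Real.inv_rpow hr.le, ← Real.rpow_neg hr.le, ← Real.rpow_neg hr.le,
    ← Real.rpow_one_add' hr.le (by linarith), one_mul, add_mul]
  congr 3 <;> ring

lemma exists_triangleProb_le_rpow (hτ : 1 < τ) (hhmin : 0 < hmin) {s : ℝ} (hs : τ - 2 < s)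
    (hs' : s < τ - 1) (hs01 : s ∈ Set.Icc 0 1) :
    ∃ K ≥ 0, ∀ N > 0, ∀ x > 0,
      triangleProb τ hmin N x ≤ K * N ^ (s - 2 * (τ - 1)) * x ^ (2 * (τ - 1 - s)) := by
  have := isProbabilityMeasure_weightLaw hτ hhmin
  obtain ⟨K, hK⟩ := exists_integral_rpow_mul_joinProb_le hτ hhmin hs hs'
  refine ⟨K ^ 2, sq_nonneg K, fun N hN x hx => ?_⟩
  calc triangleProb τ hmin N x
      ≤ N ^ (-s) * (∫ y, |y| ^ s * joinProb N s(x, y) ∂(weightLaw τ hmin)) ^ 2 :=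
        rootedTriangle_le_mul_sq (measurable_joinProb N) edgeProb_mem_Icc
          (integrable_abs_rpow_mul_joinProb hτ hhmin hs' N x) (joinProb_le_rpow hs01 hN)
    _ ≤ N ^ (-s) * (K * (x / N) ^ (τ - 1 - s)) ^ 2 := by
        gcongr
        · exact integral_nonneg fun y => mul_nonneg (by positivity) (edgeProb_mem_Icc _).1
        · exact hK N hN x hx
    _ = K ^ 2 * (N ^ (-s) * N ^ (-(2 * (τ - 1 - s)))) * x ^ (2 * (τ - 1 - s)) := by
        rw [mul_pow, ← Real.rpow_mul_natCast (by positivity), Real.div_rpow hx.le hN.le,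
          Real.rpow_neg hN.le (2 * (τ - 1 - s)), Nat.cast_ofNat, mul_comm (τ - 1 - s) 2]
        ring
    _ = K ^ 2 * N ^ (s - 2 * (τ - 1)) * x ^ (2 * (τ - 1 - s)) := by
        rw [← Real.rpow_add hN]
        ring_nf

lemma triangleProb_le_div (hτ : 2 < τ) (hhmin : 0 < hmin) {N : ℝ} (hN : 0 < N) (x : ℝ) :
    triangleProb τ hmin N x ≤ (∫ y, |y| ∂(weightLaw τ hmin)) ^ 2 / N := by
  have hτ1 : 1 < τ := by linarith
  have := isProbabilityMeasure_weightLaw hτ1 hhmin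
  have hint : Integrable (fun y => |y| * joinProb N s(x, y)) (weightLaw τ hmin) := by
    simpa only [Real.rpow_one] using
      integrable_abs_rpow_mul_joinProb hτ1 hhmin (show 1 < τ - 1 by linarith) N x
  calc triangleProb τ hmin N x
      ≤ N⁻¹ * (∫ y, |y| * joinProb N s(x, y) ∂(weightLaw τ hmin)) ^ 2 :=
        rootedTriangle_le_mul_sq (measurable_joinProb N) edgeProb_mem_Icc hint fun y z => by
          simpa only [Real.rpow_one, Real.rpow_neg_one] using
            joinProb_le_rpow (Set.right_mem_Icc.2 zero_le_one) hN y z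
    _ ≤ N⁻¹ * (∫ y, |y| ∂(weightLaw τ hmin)) ^ 2 := by
        gcongr
        · exact integral_nonneg fun y => mul_nonneg (abs_nonneg y) (edgeProb_mem_Icc _).1
        · exact (integrable_id_weightLaw hτ hhmin).abs
        · intro y
          exact mul_le_of_le_one_right (abs_nonneg y) (edgeProb_mem_Icc _).2
    _ = (∫ y, |y| ∂(weightLaw τ hmin)) ^ 2 / N := inv_mul_eq_div _ _

/-- The other two vertices may both have weight above `√N`. -/
lemma sq_weightLaw_real_Ioi_le_triangleProb (hτ : 1 < τ) (hhmin : 0 < hmin) {N x : ℝ}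
    (hN : 0 < N) (hx : √N < x) :
    (weightLaw τ hmin).real (Set.Ioi √N) ^ 2 ≤ triangleProb τ hmin N x := by
  have := isProbabilityMeasure_weightLaw hτ hhmin
  have hjoin : ∀ y ∈ Set.Ioi √N, ∀ z ∈ Set.Ioi √N, 1 ≤ joinProb N s(y, z) := fun y hy z hz => by
    refine le_joinProb le_rfl ((one_le_div hN).2 ?_)
    rw [← Real.mul_self_sqrt hN.le]
    exact mul_le_mul (le_of_lt hy) (le_of_lt hz) (Real.sqrt_nonneg _)
      ((Real.sqrt_nonneg _).trans_lt hy).le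
  rw [← one_mul (_ ^ 2)]
  exact mul_sq_measureReal_le_rootedTriangle (measurable_joinProb N) edgeProb_mem_Icc
    measurableSet_Ioi (hjoin x hx) hjoin

/-- The other two vertices may both have weight above `N / x`. -/
lemma rpow_le_triangleProb (hτ : 1 < τ) (hhmin : 0 < hmin) {N x : ℝ} (hN : 0 < N)
    (hx : √N ≤ x) (hx' : x ≤ N / hmin) :
    hmin ^ (2 * (τ - 1)) * N ^ (1 - 2 * (τ - 1)) * x ^ (2 * (τ - 2)) ≤ triangleProb τ hmin N x := by
  have := isProbabilityMeasure_weightLaw hτ hhmin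
  have hx0 : 0 < x := (Real.sqrt_pos.2 hN).trans_le hx
  have hb : N / x ^ 2 ≤ 1 := (div_le_one (by positivity)).2 ((Real.sqrt_le_left hx0.le).1 hx)
  have hmem : ∀ y ∈ Set.Ioi (N / x), N ≤ x * y := fun y hy => ((div_lt_iff₀' hx0).1 hy).le
  calc hmin ^ (2 * (τ - 1)) * N ^ (1 - 2 * (τ - 1)) * x ^ (2 * (τ - 2))
      = N / x ^ 2 * (weightLaw τ hmin).real (Set.Ioi (N / x)) ^ 2 := by
        rw [weightLaw_real_Ioi hτ hhmin ((le_div_comm₀ hx0 hhmin).1 hx'),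
          ← Real.rpow_mul_natCast (by positivity), div_div_eq_mul_div,
          Real.div_rpow (by positivity) hN.le, Real.mul_rpow hhmin.le hx0.le,
          Real.rpow_sub hN, Real.rpow_one, show 2 * (τ - 2) = (τ - 1) * (2 : ℕ) - (2 : ℕ) by
            push_cast; ring, Real.rpow_sub_natCast hx0.ne', Nat.cast_ofNat, mul_comm 2 (τ - 1)]
        ring
    _ ≤ triangleProb τ hmin N x := by
        refine mul_sq_measureReal_le_rootedTriangle (measurable_joinProb N) edgeProb_mem_Icc
          measurableSet_Ioi (fun y hy => le_joinProb le_rfl ((one_le_div hN).2 (hmem y hy)))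
          fun y hy z hz => le_joinProb hb ?_
        rw [div_le_div_iff₀ (by positivity) hN]
        nlinarith [mul_le_mul (hmem y hy) (hmem z hz) hN.le (hN.le.trans (hmem y hy))]

end RootedTriangleBounds

section PowerAsymptotics

lemma isBigO_of_nonneg_of_le_const_mul {α : Type*} {l : Filter α} {f g : α → ℝ} {c : ℝ}
    (hf : ∀ᶠ x in l, 0 ≤ f x) (hfg : ∀ᶠ x in l, f x ≤ c * g x) : f =O[l] g :=
  (Eventually.isBigO (g := fun x => c * g x) <| by
    filter_upwards [hf, hfg] with x h0 h
    rwa [Real.norm_of_nonneg h0]).trans (isBigO_const_mul_self c g l)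

lemma isBigO_rpow_rpow {a b : ℝ} (hab : a ≤ b) :
    (fun x : ℝ => x ^ a) =O[atTop] fun x : ℝ => x ^ b :=
  isBigO_of_nonneg_of_le_const_mul (c := 1)
    ((eventually_ge_atTop 0).mono fun x hx => Real.rpow_nonneg hx a)
    ((eventually_ge_atTop 1).mono fun x hx => by
      rw [one_mul]
      exact Real.rpow_le_rpow_of_exponent_le hx hab)

lemma isLittleO_rpow_rpow {a b : ℝ} (hab : a < b) :
    (fun x : ℝ => x ^ a) =o[atTop] fun x : ℝ => x ^ b := by
  refine (isLittleO_iff_tendsto' ((eventually_gt_atTop 0).mono fun x hx h =>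
    absurd h (Real.rpow_pos_of_pos hx _).ne')).2 ?_
  refine (tendsto_rpow_neg_atTop (sub_pos.2 hab)).congr'
    ((eventually_gt_atTop 0).mono fun x hx => ?_)
  simp only [← Real.rpow_sub hx, neg_sub]

lemma rpow_mul_rpow_eventuallyEq (a b : ℝ) :
    (fun x : ℝ => x ^ a * x ^ b) =ᶠ[atTop] fun x => x ^ (a + b) :=
  (eventually_gt_atTop 0).mono fun _ hx => (Real.rpow_add hx a b).symm

lemma isBigO_log_mul {f : ℝ → ℝ} : f =O[atTop] fun x => f x * Real.log x := by
  refine IsBigO.of_bound 1 ?_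
  filter_upwards [Real.tendsto_log_atTop.eventually_ge_atTop 1] with x hx
  rw [one_mul, norm_mul, Real.norm_of_nonneg (zero_le_one.trans hx)]
  exact le_mul_of_one_le_right (norm_nonneg _) hx

lemma isTheta_rpow_const_mul {m : ℝ} (hm : 0 < m) (a : ℝ) :
    (fun x : ℝ => (m * x) ^ a) =Θ[atTop] fun x => x ^ a := by
  refine EventuallyEq.trans_isTheta (f₂ := fun x => m ^ a * x ^ a)
    ((eventually_ge_atTop 0).mono fun x hx => Real.mul_rpow hm.le hx) ?_
  exact (isTheta_refl _ _).const_mul_left (Real.rpow_pos_of_pos hm a).ne'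

lemma isTheta_log_const_mul {m : ℝ} (hm : 0 < m) :
    (fun x : ℝ => Real.log (m * x)) =Θ[atTop] Real.log := by
  refine EventuallyEq.trans_isTheta (f₂ := fun x => Real.log m + Real.log x)
    ((eventually_gt_atTop 0).mono fun x hx => Real.log_mul hm.ne' hx.ne') ?_
  exact IsLittleO.add_isTheta (isLittleO_const_left.2 (Or.inr
    (tendsto_norm_atTop_atTop.comp Real.tendsto_log_atTop))) (isTheta_refl _ _)

variable {h q : ℝ}

lemma eventually_sqrt_le_div (hh : 0 < h) : ∀ᶠ x : ℝ in atTop, √x ≤ x / h := by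
  filter_upwards [eventually_ge_atTop (h ^ 2)] with x hx
  have hx0 : 0 ≤ x := (sq_nonneg h).trans hx
  rw [le_div_iff₀ hh]
  calc √x * h ≤ √x * √x := by gcongr; exact Real.le_sqrt_of_sq_le hx
    _ = x := Real.mul_self_sqrt hx0

lemma integral_rpow_eventuallyEq (hh : 0 < h) (hq : q ≠ -1) :
    (fun x : ℝ => ∫ t in (√x)..(x / h), t ^ q) =ᶠ[atTop]
      fun x => (h ^ (q + 1))⁻¹ / (q + 1) * x ^ (q + 1) + -(1 / (q + 1)) * x ^ ((q + 1) / 2) := by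
  filter_upwards [eventually_sqrt_le_div hh, eventually_gt_atTop 0] with x hx hx0
  have hsqrt : 0 < √x := Real.sqrt_pos.2 hx0
  rw [integral_rpow (Or.inr ⟨hq, Set.notMem_uIcc_of_lt hsqrt (hsqrt.trans_le hx)⟩),
    Real.div_rpow hx0.le hh.le, Real.rpow_div_two_eq_sqrt _ hx0.le]
  ring

lemma isTheta_integral_rpow_of_lt (hh : 0 < h) (hq : q < -1) :
    (fun x : ℝ => ∫ t in (√x)..(x / h), t ^ q) =Θ[atTop] fun x => x ^ ((q + 1) / 2) := by
  refine (integral_rpow_eventuallyEq hh hq.ne).trans_isTheta (IsLittleO.add_isTheta ?_ ?_)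
  · exact (isLittleO_rpow_rpow (by linarith)).const_mul_left _
  · exact (isTheta_refl _ _).const_mul_left
      (neg_ne_zero.2 (one_div_ne_zero (by linarith : q + 1 < 0).ne))

lemma isTheta_integral_rpow_of_gt (hh : 0 < h) (hq : -1 < q) :
    (fun x : ℝ => ∫ t in (√x)..(x / h), t ^ q) =Θ[atTop] fun x => x ^ (q + 1) := by
  refine (integral_rpow_eventuallyEq hh hq.ne').trans_isTheta (IsTheta.add_isLittleO ?_ ?_)
  · exact (isTheta_refl _ _).const_mul_left (div_ne_zero
      (inv_ne_zero (Real.rpow_pos_of_pos hh _).ne') (by linarith : 0 < q + 1).ne')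
  · exact (isLittleO_rpow_rpow (by linarith)).const_mul_left _

lemma isTheta_integral_rpow_neg_one (hh : 0 < h) :
    (fun x : ℝ => ∫ t in (√x)..(x / h), t ^ (-1 : ℝ)) =Θ[atTop] Real.log := by
  have heq : (fun x : ℝ => ∫ t in (√x)..(x / h), t ^ (-1 : ℝ)) =ᶠ[atTop]
      fun x => 1 / 2 * Real.log x + -Real.log h := by
    filter_upwards [eventually_sqrt_le_div hh, eventually_gt_atTop 0] with x hx hx0
    have hsqrt : 0 < √x := Real.sqrt_pos.2 hx0
    simp_rw [Real.rpow_neg_one]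
    rw [integral_inv_of_pos hsqrt (hsqrt.trans_le hx), Real.log_div (div_pos hx0 hh).ne' hsqrt.ne',
      Real.log_div hx0.ne' hh.ne', Real.log_sqrt hx0.le]
    ring
  refine heq.trans_isTheta (IsTheta.add_isLittleO ?_ ?_)
  · exact (isTheta_refl _ _).const_mul_left (by norm_num)
  · exact isLittleO_const_left.2 (Or.inr (tendsto_norm_atTop_atTop.comp Real.tendsto_log_atTop))

end PowerAsymptotics

section FluctuationOrder

/-- The order of magnitude of the relative fluctuation of the triangle count on `x` vertices with
tail exponent `τ`. -/
noncomputable def fluctOrder (τ x : ℝ) : ℝ :=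
  if τ < 7 / 3 then x ^ ((τ - 3) / 2)
  else if τ = 7 / 3 then x ^ (2 * τ - 5) * Real.log x
  else x ^ (2 * τ - 5)

variable {τ : ℝ}

lemma fluctOrder_of_lt (hτ : τ < 7 / 3) : fluctOrder τ = fun x => x ^ ((τ - 3) / 2) :=
  funext fun _ => if_pos hτ

lemma fluctOrder_of_eq (hτ : τ = 7 / 3) :
    fluctOrder τ = fun x => x ^ (2 * τ - 5) * Real.log x :=
  funext fun _ => (if_neg hτ.not_lt).trans (if_pos hτ)

lemma fluctOrder_of_gt (hτ : 7 / 3 < τ) : fluctOrder τ = fun x => x ^ (2 * τ - 5) :=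
  funext fun _ => (if_neg hτ.not_gt).trans (if_neg hτ.ne')

lemma isBigO_rpow_fluctOrder_left (τ : ℝ) :
    (fun x : ℝ => x ^ ((τ - 3) / 2)) =O[atTop] fluctOrder τ := by
  obtain hτ | hτ | hτ := lt_trichotomy τ (7 / 3)
  · exact fluctOrder_of_lt hτ ▸ isBigO_refl _ _
  · exact fluctOrder_of_eq hτ ▸ (isBigO_rpow_rpow (by linarith)).trans isBigO_log_mul
  · exact fluctOrder_of_gt hτ ▸ isBigO_rpow_rpow (by linarith)

lemma isBigO_rpow_fluctOrder_right (τ : ℝ) :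
    (fun x : ℝ => x ^ (2 * τ - 5)) =O[atTop] fluctOrder τ := by
  obtain hτ | hτ | hτ := lt_trichotomy τ (7 / 3)
  · exact fluctOrder_of_lt hτ ▸ isBigO_rpow_rpow (by linarith)
  · exact fluctOrder_of_eq hτ ▸ isBigO_log_mul
  · exact fluctOrder_of_gt hτ ▸ isBigO_refl _ _

lemma isTheta_fluctOrder_const_mul {m : ℝ} (hm : 0 < m) (τ : ℝ) :
    (fun x => fluctOrder τ (m * x)) =Θ[atTop] fluctOrder τ := by
  obtain hτ | hτ | hτ := lt_trichotomy τ (7 / 3)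
  · exact fluctOrder_of_lt hτ ▸ isTheta_rpow_const_mul hm _
  · exact fluctOrder_of_eq hτ ▸ (isTheta_rpow_const_mul hm _).mul (isTheta_log_const_mul hm)
  · exact fluctOrder_of_gt hτ ▸ isTheta_rpow_const_mul hm _

lemma isTheta_rpow_mul_integral_fluctOrder {h : ℝ} (hh : 0 < h) (τ : ℝ) :
    (fun x : ℝ => x ^ (2 - τ) * ∫ t in (√x)..(x / h), t ^ (3 * τ - 8)) =Θ[atTop]
      fluctOrder τ := by
  obtain hτ | hτ | hτ := lt_trichotomy τ (7 / 3)
  · refine ((isTheta_refl _ _).mul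
      (isTheta_integral_rpow_of_lt hh (by linarith))).trans_eventuallyEq
      ((rpow_mul_rpow_eventuallyEq _ _).trans (EventuallyEq.of_eq ?_))
    rw [fluctOrder_of_lt hτ]
    ring_nf
  · rw [fluctOrder_of_eq hτ, show 3 * τ - 8 = -1 by linarith, show 2 - τ = 2 * τ - 5 by linarith]
    exact (isTheta_refl _ _).mul (isTheta_integral_rpow_neg_one hh)
  · refine ((isTheta_refl _ _).mul
      (isTheta_integral_rpow_of_gt hh (by linarith))).trans_eventuallyEq
      ((rpow_mul_rpow_eventuallyEq _ _).trans (EventuallyEq.of_eq ?_))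
    rw [fluctOrder_of_gt hτ]
    ring_nf

lemma tendsto_fluctOrder_zero (hτ : τ < 5 / 2) : Tendsto (fluctOrder τ) atTop (𝓝 0) := by
  have hrpow : ∀ {a : ℝ}, a < 0 → Tendsto (fun x : ℝ => x ^ a) atTop (𝓝 0) := fun {a} ha => by
    simpa only [neg_neg] using tendsto_rpow_neg_atTop (neg_pos.2 ha)
  obtain h | h | h := lt_trichotomy τ (7 / 3)
  · exact fluctOrder_of_lt h ▸ hrpow (by linarith)
  · rw [fluctOrder_of_eq h]
    refine (isLittleO_log_rpow_atTop
      (show 0 < 5 - 2 * τ by linarith)).tendsto_div_nhds_zero.congr' ?_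
    filter_upwards [eventually_ge_atTop 0] with x hx
    rw [← neg_sub (5 : ℝ), Real.rpow_neg hx, div_eq_inv_mul]
  · exact fluctOrder_of_gt h ▸ hrpow (by linarith)

lemma tendsto_fluctOrder_atTop (hτ : 5 / 2 < τ) : Tendsto (fluctOrder τ) atTop atTop := by
  rw [fluctOrder_of_gt (by linarith)]
  exact tendsto_rpow_atTop (by linarith)

end FluctuationOrder

section TriangleMoments

variable {τ hmin : ℝ}

lemma triangleProb_mem_Icc (hτ : 1 < τ) (hhmin : 0 < hmin) (N x : ℝ) :
    triangleProb τ hmin N x ∈ Set.Icc 0 1 :=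
  have := isProbabilityMeasure_weightLaw hτ hhmin
  rootedTriangle_mem_Icc (measurable_joinProb N) (fun _ => edgeProb_mem_Icc _) x

lemma triangleProb_pow_nonneg (hτ : 1 < τ) (hhmin : 0 < hmin) (N x : ℝ) (p : ℕ) :
    0 ≤ triangleProb τ hmin N x ^ p :=
  pow_nonneg (triangleProb_mem_Icc hτ hhmin N x).1 p

lemma integrable_triangleProb_pow (hτ : 1 < τ) (hhmin : 0 < hmin) (N : ℝ) (p : ℕ) :
    Integrable (fun x => triangleProb τ hmin N x ^ p) (weightLaw τ hmin) := by
  have := isProbabilityMeasure_weightLaw hτ hhmin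
  have hmem := triangleProb_mem_Icc hτ hhmin N
  exact integrable_of_mem_Icc ((measurable_rootedTriangle (measurable_joinProb N)).pow_const p)
    fun x => ⟨pow_nonneg (hmem x).1 p, pow_le_one₀ (hmem x).1 (hmem x).2⟩

lemma isBigO_setIntegral_Iic_triangleProb_pow (hτ : 2 < τ) (hτ' : τ < 3) (hhmin : 0 < hmin)
    {p : ℕ} (hp : 1 ≤ p) :
    (fun N => ∫ x in Set.Iic √N, triangleProb τ hmin N x ^ p ∂(weightLaw τ hmin)) =O[atTop]
      fun N => N ^ (-((p + 1 / 2) * (τ - 1))) := by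
  have hτ1 : 1 < τ := by linarith
  -- any `s` between `τ - 2` and `(τ - 1) / 2` makes the integral concentrate near `√N`
  obtain ⟨s, hs, hs'⟩ := exists_between (show τ - 2 < (τ - 1) / 2 by linarith)
  obtain ⟨K, hK, hle⟩ := exists_triangleProb_le_rpow hτ1 hhmin hs (by linarith)
    ⟨by linarith, by linarith⟩
  have hexp : τ - 1 < 2 * (τ - 1 - s) * p := by
    have : (1 : ℝ) ≤ p := by exact_mod_cast hp
    nlinarith
  refine isBigO_of_nonneg_of_le_const_mul
    (c := densityConst τ hmin / (2 * (τ - 1 - s) * p - (τ - 1)) * K ^ p)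
    (Eventually.of_forall fun N => integral_nonneg fun x => triangleProb_pow_nonneg hτ1 hhmin N x p)
    ((eventually_gt_atTop 0).mono fun N hN => ?_)
  refine (setIntegral_Iic_weightLaw_le_of_le_rpow (A := (K * N ^ (s - 2 * (τ - 1))) ^ p) hτ1 hhmin
    hexp (Real.sqrt_nonneg N) (by positivity) (fun x => triangleProb_pow_nonneg hτ1 hhmin N x p)
    fun x hx => ?_).trans_eq ?_
  · rw [Real.rpow_mul_natCast hx.1.le, ← mul_pow]
    exact pow_le_pow_left₀ (triangleProb_mem_Icc hτ1 hhmin N x).1 (hle N hN x hx.1) p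
  · rw [← Real.rpow_div_two_eq_sqrt _ hN.le, mul_pow, ← Real.rpow_mul_natCast hN.le,
      mul_assoc (K ^ p), ← Real.rpow_add hN, mul_assoc]
    ring_nf

lemma isBigO_setIntegral_Ioi_triangleProb (hτ : 2 < τ) (hτ' : τ < 3) (hhmin : 0 < hmin) :
    (fun N => ∫ x in Set.Ioi √N, triangleProb τ hmin N x ∂(weightLaw τ hmin)) =O[atTop]
      fun N => N ^ (-(3 / 2 * (τ - 1))) := by
  have hτ1 : 1 < τ := by linarith
  have hnn : ∀ N x, 0 ≤ triangleProb τ hmin N x := fun N x => (triangleProb_mem_Icc hτ1 hhmin N x).1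
  obtain ⟨K, hK, hle⟩ := exists_triangleProb_le_rpow hτ1 hhmin
    (show τ - 2 < 1 by linarith) (by linarith) (Set.right_mem_Icc.2 zero_le_one)
  refine isBigO_of_nonneg_of_le_const_mul
    (c := densityConst τ hmin / (τ - 1 - 2 * (τ - 1 - 1)) * K)
    (Eventually.of_forall fun N => integral_nonneg (hnn N))
    ((eventually_gt_atTop 0).mono fun N hN => ?_)
  refine (setIntegral_Ioi_weightLaw_le_of_le_rpow hτ1 hhmin (by linarith)
    (Real.sqrt_pos.2 hN) (by positivity) (hnn N)
    fun x hx => hle N hN x ((Real.sqrt_nonneg N).trans_lt hx)).trans_eq ?_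
  rw [← Real.rpow_div_two_eq_sqrt _ hN.le, mul_assoc K, ← Real.rpow_add hN, mul_assoc]
  ring_nf

lemma isBigO_integral_triangleProb (hτ : 2 < τ) (hhmin : 0 < hmin) :
    (fun N : ℝ => N ^ (-(3 / 2 * (τ - 1)))) =O[atTop]
      fun N => ∫ x, triangleProb τ hmin N x ∂(weightLaw τ hmin) := by
  have hτ1 : 1 < τ := by linarith
  have := isProbabilityMeasure_weightLaw hτ1 hhmin
  refine isBigO_of_nonneg_of_le_const_mul (c := (hmin ^ (3 * (τ - 1)))⁻¹)
    ((eventually_ge_atTop 0).mono fun N hN => Real.rpow_nonneg hN _) ?_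
  filter_upwards [eventually_gt_atTop 0, eventually_ge_atTop (hmin ^ 2)] with N hN hN'
  have hint : Integrable (triangleProb τ hmin N) (weightLaw τ hmin) := by
    simpa only [pow_one] using integrable_triangleProb_pow hτ1 hhmin N 1
  have hmean : (weightLaw τ hmin).real (Set.Ioi √N) ^ 3
      ≤ ∫ x, triangleProb τ hmin N x ∂(weightLaw τ hmin) :=
    calc (weightLaw τ hmin).real (Set.Ioi √N) ^ 3
        = ∫ _ in Set.Ioi √N, (weightLaw τ hmin).real (Set.Ioi √N) ^ 2 ∂(weightLaw τ hmin) := by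
          rw [setIntegral_const, smul_eq_mul]
          ring
      _ ≤ ∫ x in Set.Ioi √N, triangleProb τ hmin N x ∂(weightLaw τ hmin) :=
          setIntegral_mono_on (integrable_const _).integrableOn hint.integrableOn measurableSet_Ioi
            fun x hx => sq_weightLaw_real_Ioi_le_triangleProb hτ1 hhmin hN hx
      _ ≤ ∫ x, triangleProb τ hmin N x ∂(weightLaw τ hmin) :=
          setIntegral_le_integral hint
            (ae_of_all _ fun x => (triangleProb_mem_Icc hτ1 hhmin N x).1)
  rw [inv_mul_eq_div, le_div_iff₀' (by positivity)]
  refine le_of_eq_of_le ?_ hmean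
  rw [weightLaw_real_Ioi hτ1 hhmin (Real.le_sqrt_of_sq_le hN'), ← Real.rpow_mul_natCast
    (by positivity), Real.div_rpow hhmin.le (Real.sqrt_nonneg N),
    ← Real.rpow_div_two_eq_sqrt _ hN.le, div_eq_mul_inv (hmin ^ ((τ - 1) * (3 : ℕ))),
    ← Real.rpow_neg hN.le]
  push_cast
  ring_nf

theorem isTheta_integral_triangleProb (hτ : 2 < τ) (hτ' : τ < 3) (hhmin : 0 < hmin) :
    (fun N => ∫ x, triangleProb τ hmin N x ∂(weightLaw τ hmin)) =Θ[atTop]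
      fun N => N ^ (-(3 / 2 * (τ - 1))) := by
  refine ⟨?_, isBigO_integral_triangleProb hτ hhmin⟩
  have hsplit : ∀ N, ∫ x in Set.Iic √N, triangleProb τ hmin N x ∂(weightLaw τ hmin)
      + ∫ x in Set.Ioi √N, triangleProb τ hmin N x ∂(weightLaw τ hmin)
      = ∫ x, triangleProb τ hmin N x ∂(weightLaw τ hmin) := fun N => by
    have hint := integrable_triangleProb_pow (show 1 < τ by linarith) hhmin N 1
    simp only [pow_one] at hint
    exact intervalIntegral.integral_Iic_add_Ioi hint.integrableOn hint.integrableOn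
  simp only [← hsplit]
  refine IsBigO.add ?_ (isBigO_setIntegral_Ioi_triangleProb hτ hτ' hhmin)
  simpa only [pow_one, Nat.cast_one, show (1 : ℝ) + 1 / 2 = 3 / 2 by norm_num]
    using isBigO_setIntegral_Iic_triangleProb_pow hτ hτ' hhmin le_rfl

lemma isBigO_setIntegral_Ioi_triangleProb_sq (hτ : 2 < τ) (hhmin : 0 < hmin) :
    (fun N => ∫ x in Set.Ioi N, triangleProb τ hmin N x ^ 2 ∂(weightLaw τ hmin)) =O[atTop]
      fun N => N ^ (-(τ + 1)) := by
  have hτ1 : 1 < τ := by linarith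
  refine isBigO_of_nonneg_of_le_const_mul (c := densityConst τ hmin / (τ - 1)
      * ((∫ y, |y| ∂(weightLaw τ hmin)) ^ 2) ^ 2)
    (Eventually.of_forall fun N => integral_nonneg fun x => sq_nonneg _)
    ((eventually_gt_atTop 0).mono fun N hN => ?_)
  refine (setIntegral_Ioi_weightLaw_le_of_le_rpow (a := 0)
    (A := ((∫ y, |y| ∂(weightLaw τ hmin)) ^ 2 / N) ^ 2) hτ1 hhmin (by linarith) hN (by positivity)
    (fun x => sq_nonneg _) fun x _ => ?_).trans_eq ?_
  · rw [Real.rpow_zero, mul_one]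
    exact pow_le_pow_left₀ (triangleProb_mem_Icc hτ1 hhmin N x).1
      (triangleProb_le_div hτ hhmin hN x) 2
  · rw [div_pow, ← Real.rpow_natCast N 2, div_eq_mul_inv (_ ^ 2), ← Real.rpow_neg hN.le,
      mul_assoc (_ ^ 2), ← Real.rpow_add hN, mul_assoc]
    push_cast
    ring_nf

lemma rpow_mul_integral_rpow_eq {N : ℝ} (hN : 0 < N) (τ h : ℝ) :
    (N ^ (1 - 2 * (τ - 1))) ^ 2 * ∫ t in (√N)..(N / h), t ^ (3 * τ - 8)
      = N ^ (4 - 3 * τ) * (N ^ (2 - τ) * ∫ t in (√N)..(N / h), t ^ (3 * τ - 8)) := by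
  rw [← mul_assoc, ← Real.rpow_add hN, ← Real.rpow_mul_natCast hN.le]
  push_cast
  ring_nf

lemma const_mul_rpow_sq (c : ℝ) {N x : ℝ} (hx : 0 ≤ x) :
    (c * N ^ (1 - 2 * (τ - 1)) * x ^ (2 * (τ - 2))) ^ 2
      = c ^ 2 * (N ^ (1 - 2 * (τ - 1))) ^ 2 * x ^ (4 * (τ - 2)) := by
  rw [mul_pow, mul_pow, ← Real.rpow_mul_natCast hx]
  push_cast
  ring_nf

lemma integrableOn_const_mul_rpow_sq (hτ : 1 < τ) (hhmin : 0 < hmin) {N b c d : ℝ}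
    (hb : 0 < b) :
    IntegrableOn (fun x => (d * N ^ (1 - 2 * (τ - 1)) * x ^ (2 * (τ - 2))) ^ 2) (Set.Ioc b c)
      (weightLaw τ hmin) :=
  IntegrableOn.congr_fun (Integrable.const_mul (integrableOn_Ioc_rpow_weightLaw hτ hhmin _ hb c) _)
    (fun _ hx => (const_mul_rpow_sq d (hb.trans hx.1).le).symm) measurableSet_Ioc

lemma setIntegral_Ioc_const_mul_rpow_sq (hτ : 1 < τ) (hhmin : 0 < hmin) {N h : ℝ}
    (hN : hmin ≤ √N) (hN' : √N ≤ N / h) (c : ℝ) :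
    ∫ x in Set.Ioc √N (N / h), (c * N ^ (1 - 2 * (τ - 1)) * x ^ (2 * (τ - 2))) ^ 2
        ∂(weightLaw τ hmin)
      = c ^ 2 * densityConst τ hmin
        * (N ^ (4 - 3 * τ) * (N ^ (2 - τ) * ∫ t in (√N)..(N / h), t ^ (3 * τ - 8))) := by
  have hN0 : 0 < N := Real.sqrt_pos.1 (hhmin.trans_le hN)
  rw [setIntegral_congr_fun measurableSet_Ioc fun x hx =>
      const_mul_rpow_sq c ((Real.sqrt_nonneg N).trans hx.1.le), integral_const_mul,
    setIntegral_Ioc_rpow_weightLaw hτ hhmin _ hN hN', show 4 * (τ - 2) - τ = 3 * τ - 8 by ring,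
    ← rpow_mul_integral_rpow_eq hN0]
  ring

lemma isBigO_setIntegral_Ioc_triangleProb_sq (hτ : 2 < τ) (hτ' : τ < 3) (hhmin : 0 < hmin) :
    (fun N => ∫ x in Set.Ioc √N N, triangleProb τ hmin N x ^ 2 ∂(weightLaw τ hmin)) =O[atTop]
      fun N => N ^ (4 - 3 * τ) * fluctOrder τ N := by
  have hτ1 : 1 < τ := by linarith
  obtain ⟨K, -, hle⟩ := exists_triangleProb_le_rpow hτ1 hhmin
    (show τ - 2 < 1 by linarith) (by linarith) (Set.right_mem_Icc.2 zero_le_one)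
  refine IsBigO.trans ?_ ((isBigO_refl (fun N : ℝ => N ^ (4 - 3 * τ)) atTop).mul
    (isTheta_rpow_mul_integral_fluctOrder one_pos τ).1)
  refine isBigO_of_nonneg_of_le_const_mul (c := K ^ 2 * densityConst τ hmin)
    (Eventually.of_forall fun N => integral_nonneg fun x => sq_nonneg _) ?_
  filter_upwards [eventually_gt_atTop 0, eventually_ge_atTop (hmin ^ 2),
    eventually_sqrt_le_div one_pos] with N hN hN' hsqrt
  have hIoc : Set.Ioc √N N = Set.Ioc √N (N / 1) := by rw [div_one]
  rw [← setIntegral_Ioc_const_mul_rpow_sq hτ1 hhmin (Real.le_sqrt_of_sq_le hN') hsqrt K, hIoc]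
  refine setIntegral_mono_on (integrable_triangleProb_pow hτ1 hhmin N 2).integrableOn
    (integrableOn_const_mul_rpow_sq hτ1 hhmin (Real.sqrt_pos.2 hN)) measurableSet_Ioc fun x hx => ?_
  have hx' := hle N hN x ((Real.sqrt_nonneg N).trans_lt hx.1)
  rw [show τ - 1 - 1 = τ - 2 by ring] at hx'
  exact pow_le_pow_left₀ (triangleProb_mem_Icc hτ1 hhmin N x).1 hx' 2

lemma isBigO_integral_triangleProb_sq (hτ : 1 < τ) (hhmin : 0 < hmin) :
    (fun N => N ^ (4 - 3 * τ) * fluctOrder τ N) =O[atTop]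
      fun N => ∫ x, triangleProb τ hmin N x ^ 2 ∂(weightLaw τ hmin) := by
  refine ((isBigO_refl (fun N : ℝ => N ^ (4 - 3 * τ)) atTop).mul
    (isTheta_rpow_mul_integral_fluctOrder hhmin τ).2).trans ?_
  have hc : 0 < (hmin ^ (2 * (τ - 1))) ^ 2 * densityConst τ hmin :=
    mul_pos (by positivity) (densityConst_pos hτ hhmin)
  refine isBigO_of_nonneg_of_le_const_mul
    (c := ((hmin ^ (2 * (τ - 1))) ^ 2 * densityConst τ hmin)⁻¹) ?_ ?_
  · filter_upwards [eventually_ge_atTop 0, eventually_sqrt_le_div hhmin] with N hN hsqrt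
    have hint : 0 ≤ ∫ t in (√N)..(N / hmin), t ^ (3 * τ - 8) :=
      intervalIntegral.integral_nonneg hsqrt fun t ht =>
        Real.rpow_nonneg ((Real.sqrt_nonneg N).trans ht.1) _
    positivity
  filter_upwards [eventually_gt_atTop 0, eventually_ge_atTop (hmin ^ 2),
    eventually_sqrt_le_div hhmin] with N hN hN' hsqrt
  have hint := integrable_triangleProb_pow hτ hhmin N 2
  rw [inv_mul_eq_div, le_div_iff₀' hc,
    ← setIntegral_Ioc_const_mul_rpow_sq hτ hhmin (Real.le_sqrt_of_sq_le hN') hsqrt]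
  refine (setIntegral_mono_on (integrableOn_const_mul_rpow_sq hτ hhmin (Real.sqrt_pos.2 hN))
    hint.integrableOn measurableSet_Ioc fun x hx => ?_).trans
    (setIntegral_le_integral hint (ae_of_all _ fun x => sq_nonneg _))
  have hx0 : 0 ≤ x := (Real.sqrt_nonneg N).trans hx.1.le
  exact pow_le_pow_left₀ (by positivity) (rpow_le_triangleProb hτ hhmin hN hx.1.le hx.2) 2

/-- Near `√N` the square of `triangleProb` contributes `N ^ ((τ - 3) / 2)`, near the natural cutoff
`N` it contributes `N ^ (2 * τ - 5)`, in units of `N ^ (4 - 3 * τ)`. -/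
theorem isTheta_integral_triangleProb_sq (hτ : 2 < τ) (hτ' : τ < 3) (hhmin : 0 < hmin) :
    (fun N => ∫ x, triangleProb τ hmin N x ^ 2 ∂(weightLaw τ hmin)) =Θ[atTop]
      fun N => N ^ (4 - 3 * τ) * fluctOrder τ N := by
  refine ⟨?_, isBigO_integral_triangleProb_sq (by linarith) hhmin⟩
  have hsplit : (fun N => ∫ x, triangleProb τ hmin N x ^ 2 ∂(weightLaw τ hmin)) =ᶠ[atTop]
      fun N => ∫ x in Set.Iic √N, triangleProb τ hmin N x ^ 2 ∂(weightLaw τ hmin)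
        + (∫ x in Set.Ioc √N N, triangleProb τ hmin N x ^ 2 ∂(weightLaw τ hmin)
        + ∫ x in Set.Ioi N, triangleProb τ hmin N x ^ 2 ∂(weightLaw τ hmin)) := by
    filter_upwards [eventually_sqrt_le_div one_pos] with N hN
    have hint := integrable_triangleProb_pow (show 1 < τ by linarith) hhmin N 2
    rw [← setIntegral_union (Set.Ioc_disjoint_Ioi le_rfl) measurableSet_Ioi hint.integrableOn
      hint.integrableOn, Set.Ioc_union_Ioi_eq_Ioi (hN.trans_eq (div_one N)),
      intervalIntegral.integral_Iic_add_Ioi hint.integrableOn hint.integrableOn]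
  have hmono : ∀ {a b : ℝ}, a = 4 - 3 * τ + b → (fun N : ℝ => N ^ b) =O[atTop] fluctOrder τ →
      (fun N : ℝ => N ^ a) =O[atTop] fun N => N ^ (4 - 3 * τ) * fluctOrder τ N :=
    fun {a b} hab hb => hab ▸ (rpow_mul_rpow_eventuallyEq _ _).symm.trans_isBigO
      ((isBigO_refl _ _).mul hb)
  refine hsplit.trans_isBigO (IsBigO.add ?_ (IsBigO.add ?_ ?_))
  · refine (isBigO_setIntegral_Iic_triangleProb_pow hτ hτ' hhmin one_le_two).trans
      (hmono ?_ (isBigO_rpow_fluctOrder_left τ))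
    push_cast
    ring
  · exact isBigO_setIntegral_Ioc_triangleProb_sq hτ hτ' hhmin
  · exact (isBigO_setIntegral_Ioi_triangleProb_sq hτ hhmin).trans
      (hmono (by ring) (isBigO_rpow_fluctOrder_right τ))

end TriangleMoments

section Densities

variable {τ hmin : ℝ}

theorem isTheta_homDensity_triangle (hτ : 2 < τ) (hτ' : τ < 3) (hhmin : 0 < hmin) :
    (fun N => homDensity (weightLaw τ hmin) (joinProb N) triangle) =Θ[atTop]
      fun N => N ^ (-(3 / 2 * (τ - 1))) := by
  have := isProbabilityMeasure_weightLaw (show 1 < τ by linarith) hhmin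
  simpa only [homDensity_triangle (measurable_joinProb _) fun _ => edgeProb_mem_Icc _] using
    isTheta_integral_triangleProb hτ hτ' hhmin

theorem isTheta_homDensity_bowTie (hτ : 2 < τ) (hτ' : τ < 3) (hhmin : 0 < hmin) :
    (fun N => homDensity (weightLaw τ hmin) (joinProb N) bowTie) =Θ[atTop]
      fun N => N ^ (4 - 3 * τ) * fluctOrder τ N := by
  have := isProbabilityMeasure_weightLaw (show 1 < τ by linarith) hhmin
  simpa only [homDensity_bowTie (measurable_joinProb _) fun _ => edgeProb_mem_Icc _] using
    isTheta_integral_triangleProb_sq hτ hτ' hhmin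

theorem isLittleO_homDensity_diamond (hτ : 2 < τ) (hτ' : τ < 3) (hhmin : 0 < hmin) :
    (fun N => homDensity (weightLaw τ hmin) (joinProb N) diamond) =o[atTop]
      fun N => N ^ ((7 - 5 * τ) / 2) := by
  have hτ1 : 1 < τ := by linarith
  have := isProbabilityMeasure_weightLaw hτ1 hhmin
  obtain ⟨s, hs, hs'⟩ := exists_between (show (5 * τ - 7) / 8 < (τ - 1) / 2 by linarith)
  have hsq : ∀ x : ℝ, (|x| ^ s) ^ 2 = |x| ^ (s * 2) := fun x =>
    (Real.rpow_mul_natCast (abs_nonneg x) s 2).symm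
  have hint : Integrable (fun x => (|x| ^ s) ^ 2) (weightLaw τ hmin) := by
    simpa only [hsq] using integrable_abs_rpow_weightLaw hτ1 hhmin (s := s * 2) (by linarith)
  refine IsBigO.trans_isLittleO (g := fun N : ℝ => N ^ (-s * 4)) ?_
    (isLittleO_rpow_rpow (by linarith))
  refine isBigO_of_nonneg_of_le_const_mul (c := (∫ x, (|x| ^ s) ^ 2 ∂(weightLaw τ hmin)) ^ 4)
    (Eventually.of_forall fun N => integral_nonneg fun x =>
      (edgeWeight_mem_Icc (fun _ => edgeProb_mem_Icc _) _ x).1)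
    ((eventually_gt_atTop 0).mono fun N hN => ?_)
  refine (homDensity_diamond_le (measurable_joinProb N) (fun _ => edgeProb_mem_Icc _)
    (joinProb_le_rpow ⟨by linarith, by linarith⟩ hN) hint).trans_eq ?_
  rw [mul_pow, mul_comm, ← Real.rpow_mul_natCast hN.le]
  norm_cast

end Densities

section MotifMoments

variable {τ hmin : ℝ}

lemma isTheta_comp_const_mul_natCast {f g : ℝ → ℝ} {m : ℝ} (hm : 0 < m) (hfg : f =Θ[atTop] g)
    (hg : (fun x => g (m * x)) =Θ[atTop] g) :
    (fun n : ℕ => f (m * n)) =Θ[atTop] fun n : ℕ => g n :=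
  have hmul : Tendsto (fun x : ℝ => m * x) atTop atTop := tendsto_id.const_mul_atTop hm
  have h : (fun x => f (m * x)) =Θ[atTop] g :=
    IsTheta.trans ⟨hfg.1.comp_tendsto hmul, hfg.2.comp_tendsto hmul⟩ hg
  ⟨h.1.comp_tendsto tendsto_natCast_atTop_atTop, h.2.comp_tendsto tendsto_natCast_atTop_atTop⟩

lemma isTheta_descFactorial (k : ℕ) :
    (fun n : ℕ => (n.descFactorial k : ℝ)) =Θ[atTop] fun n : ℕ => (n : ℝ) ^ (k : ℝ) := by
  simp only [Real.rpow_natCast]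
  exact (isEquivalent_descFactorial k).isTheta

lemma natCast_rpow_mul_rpow_eventuallyEq {a b c : ℝ} (h : a + b = c) :
    (fun n : ℕ => (n : ℝ) ^ a * (n : ℝ) ^ b) =ᶠ[atTop] fun n : ℕ => (n : ℝ) ^ c :=
  h ▸ (rpow_mul_rpow_eventuallyEq a b).comp_tendsto tendsto_natCast_atTop_atTop

lemma isLittleO_natCast_rpow {a b : ℝ} (hab : a < b) :
    (fun n : ℕ => (n : ℝ) ^ a) =o[atTop] fun n : ℕ => (n : ℝ) ^ b :=
  (isLittleO_rpow_rpow hab).comp_tendsto tendsto_natCast_atTop_atTop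

lemma expect_motifCount (hτ : 1 < τ) (hhmin : 0 < hmin) {k : ℕ} (H : SimpleGraph (Fin k))
    (n : ℕ) :
    expect τ hmin n (motifCount H) = n.descFactorial k
      * homDensity (weightLaw τ hmin) (joinProb (meanWeight τ hmin * n)) H :=
  have := isProbabilityMeasure_weightLaw hτ hhmin
  integral_motifCount (measurable_connKernel _) H

lemma isTheta_expect_triangle (hτ : 2 < τ) (hτ' : τ < 3) (hhmin : 0 < hmin) :
    (fun n => expect τ hmin n (motifCount triangle)) =Θ[atTop]
      fun n : ℕ => (n : ℝ) ^ ((9 - 3 * τ) / 2) := by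
  have hm := meanWeight_pos hτ hhmin
  simp only [expect_motifCount (show 1 < τ by linarith) hhmin]
  refine ((isTheta_descFactorial 3).mul (isTheta_comp_const_mul_natCast hm
    (isTheta_homDensity_triangle hτ hτ' hhmin) (isTheta_rpow_const_mul hm _))).trans_eventuallyEq
    (natCast_rpow_mul_rpow_eventuallyEq ?_)
  push_cast
  ring

lemma isTheta_expect_triangle_sq (hτ : 2 < τ) (hτ' : τ < 3) (hhmin : 0 < hmin) :
    (fun n => expect τ hmin n (motifCount triangle) ^ 2) =Θ[atTop]
      fun n : ℕ => (n : ℝ) ^ (9 - 3 * τ) := by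
  simp only [sq]
  exact ((isTheta_expect_triangle hτ hτ' hhmin).mul
    (isTheta_expect_triangle hτ hτ' hhmin)).trans_eventuallyEq
    (natCast_rpow_mul_rpow_eventuallyEq (by ring))

lemma isTheta_expect_bowTie (hτ : 2 < τ) (hτ' : τ < 3) (hhmin : 0 < hmin) :
    (fun n => expect τ hmin n (motifCount bowTie)) =Θ[atTop]
      fun n : ℕ => (n : ℝ) ^ (9 - 3 * τ) * fluctOrder τ n := by
  have hm := meanWeight_pos hτ hhmin
  simp only [expect_motifCount (show 1 < τ by linarith) hhmin]
  refine ((isTheta_descFactorial 5).mul (isTheta_comp_const_mul_natCast hm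
    (isTheta_homDensity_bowTie hτ hτ' hhmin)
    ((isTheta_rpow_const_mul hm _).mul (isTheta_fluctOrder_const_mul hm τ)))).trans_eventuallyEq ?_
  simp only [← mul_assoc]
  refine (natCast_rpow_mul_rpow_eventuallyEq ?_).mul EventuallyEq.rfl
  push_cast
  ring

lemma isLittleO_expect_diamond (hτ : 2 < τ) (hτ' : τ < 3) (hhmin : 0 < hmin) :
    (fun n => expect τ hmin n (motifCount diamond)) =o[atTop]
      fun n : ℕ => (n : ℝ) ^ ((15 - 5 * τ) / 2) := by
  have hm := meanWeight_pos hτ hhmin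
  simp only [expect_motifCount (show 1 < τ by linarith) hhmin]
  refine ((isTheta_descFactorial 4).1.mul_isLittleO
    (((isLittleO_homDensity_diamond hτ hτ' hhmin).comp_tendsto
      (tendsto_natCast_atTop_atTop.const_mul_atTop hm)).trans_isTheta
      (isTheta_comp_const_mul_natCast hm (isTheta_refl (fun N : ℝ => N ^ ((7 - 5 * τ) / 2)) _)
        (isTheta_rpow_const_mul hm _)))).trans_eventuallyEq
    (natCast_rpow_mul_rpow_eventuallyEq ?_)
  push_cast
  ring

end MotifMoments

section TriangleFluctuations

variable {τ hmin : ℝ}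

lemma var_motifCount_triangle (hτ : 1 < τ) (hhmin : 0 < hmin) (n : ℕ) :
    var τ hmin n (motifCount triangle)
      = 9 * n.descFactorial 5
            * (homDensity (weightLaw τ hmin) (joinProb (meanWeight τ hmin * n)) bowTie
              - homDensity (weightLaw τ hmin) (joinProb (meanWeight τ hmin * n)) triangle ^ 2)
        + 18 * n.descFactorial 4
            * (homDensity (weightLaw τ hmin) (joinProb (meanWeight τ hmin * n)) diamond
              - homDensity (weightLaw τ hmin) (joinProb (meanWeight τ hmin * n)) triangle ^ 2)
        + 6 * n.descFactorial 3
            * (homDensity (weightLaw τ hmin) (joinProb (meanWeight τ hmin * n)) triangle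
              - homDensity (weightLaw τ hmin) (joinProb (meanWeight τ hmin * n)) triangle ^ 2) := by
  have := isProbabilityMeasure_weightLaw hτ hhmin
  have hgraph : randomGraph τ hmin n = kernelGraph (connKernel (meanWeight τ hmin * n)) := rfl
  have hlaw : sampleLaw τ hmin n = kernelGraphLaw (Fin n) (weightLaw τ hmin) := rfl
  rw [var, hgraph, hlaw]
  exact variance_motifCount_triangle (measurable_connKernel _)

lemma var_motifCount_triangle_sub (hτ : 1 < τ) (hhmin : 0 < hmin) (n : ℕ) :
    var τ hmin n (motifCount triangle)
        - (9 * expect τ hmin n (motifCount bowTie) + 18 * expect τ hmin n (motifCount diamond)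
          + 6 * expect τ hmin n (motifCount triangle))
      = -((9 * n.descFactorial 5 + 18 * n.descFactorial 4 + 6 * n.descFactorial 3)
        * homDensity (weightLaw τ hmin) (joinProb (meanWeight τ hmin * n)) triangle ^ 2) := by
  rw [var_motifCount_triangle hτ hhmin]
  simp only [expect_motifCount hτ hhmin]
  ring

lemma isBigO_descFactorial_add_add :
    (fun n : ℕ => (9 * n.descFactorial 5 + 18 * n.descFactorial 4 + 6 * n.descFactorial 3 : ℝ))
      =O[atTop] fun n : ℕ => (n : ℝ)⁻¹ * (n.descFactorial 3 : ℝ) ^ 2 := by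
  have hle : ∀ k ≤ 5, ∀ c : ℝ, (fun n : ℕ => c * (n.descFactorial k : ℝ)) =O[atTop]
      fun n : ℕ => (n : ℝ) ^ (5 : ℝ) := fun k hk c =>
    ((isTheta_descFactorial k).1.trans ((isBigO_rpow_rpow (by exact_mod_cast hk)).comp_tendsto
      tendsto_natCast_atTop_atTop)).const_mul_left c
  have hright : (fun n : ℕ => (n : ℝ)⁻¹ * (n.descFactorial 3 : ℝ) ^ 2) =Θ[atTop]
      fun n : ℕ => (n : ℝ) ^ (5 : ℝ) := by
    simp only [sq, ← Real.rpow_neg_one]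
    refine ((isTheta_refl _ _).mul (((isTheta_descFactorial 3).mul
      (isTheta_descFactorial 3)).trans_eventuallyEq
      (natCast_rpow_mul_rpow_eventuallyEq rfl))).trans_eventuallyEq
      (natCast_rpow_mul_rpow_eventuallyEq ?_)
    norm_num
  exact (((hle 5 le_rfl 9).add (hle 4 (by norm_num) 18)).add (hle 3 (by norm_num) 6)).trans
    hright.2

theorem isBigO_var_motifCount_triangle_sub (hτ : 1 < τ) (hhmin : 0 < hmin) :
    (fun n => var τ hmin n (motifCount triangle)
        - (9 * expect τ hmin n (motifCount bowTie) + 18 * expect τ hmin n (motifCount diamond)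
          + 6 * expect τ hmin n (motifCount triangle)))
      =O[atTop] fun n : ℕ => (n : ℝ)⁻¹ * expect τ hmin n (motifCount triangle) ^ 2 := by
  simp only [var_motifCount_triangle_sub hτ hhmin]
  simp only [expect_motifCount hτ hhmin, mul_pow, ← mul_assoc]
  exact (isBigO_descFactorial_add_add.mul (isBigO_refl _ _)).neg_left

/-- The bow-ties dominate: each of the other contributions is `o(n ^ ((15 - 5 * τ) / 2))`, and
`n ^ ((15 - 5 * τ) / 2) = n ^ (9 - 3 * τ) * n ^ ((τ - 3) / 2)`. -/
lemma isTheta_var_motifCount_triangle (hτ : 2 < τ) (hτ' : τ < 3) (hhmin : 0 < hmin) :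
    (fun n => var τ hmin n (motifCount triangle)) =Θ[atTop]
      fun n : ℕ => (n : ℝ) ^ (9 - 3 * τ) * fluctOrder τ n := by
  have hE := isTheta_expect_triangle hτ hτ' hhmin
  have hbowTie := (isTheta_expect_bowTie hτ hτ' hhmin).const_mul_left (c := 9) (by norm_num)
  have hdiamond := (isLittleO_expect_diamond hτ hτ' hhmin).const_mul_left 18
  have htriangle : (fun n => 6 * expect τ hmin n (motifCount triangle)) =o[atTop]
      fun n : ℕ => (n : ℝ) ^ ((15 - 5 * τ) / 2) :=
    (hE.1.trans_isLittleO (isLittleO_natCast_rpow (by linarith))).const_mul_left 6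
  have herror : (fun n => var τ hmin n (motifCount triangle)
        - (9 * expect τ hmin n (motifCount bowTie) + 18 * expect τ hmin n (motifCount diamond)
          + 6 * expect τ hmin n (motifCount triangle))) =o[atTop]
      fun n : ℕ => (n : ℝ) ^ ((15 - 5 * τ) / 2) := by
    refine (isBigO_var_motifCount_triangle_sub (by linarith) hhmin).trans_isLittleO ?_
    simp only [← Real.rpow_neg_one]
    exact (((isTheta_refl _ _).mul (isTheta_expect_triangle_sq hτ hτ' hhmin)).trans_eventuallyEq
      (natCast_rpow_mul_rpow_eventuallyEq rfl)).1.trans_isLittleO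
      (isLittleO_natCast_rpow (by linarith))
  have hdominated : (fun n : ℕ => (n : ℝ) ^ ((15 - 5 * τ) / 2)) =O[atTop]
      fun n : ℕ => (n : ℝ) ^ (9 - 3 * τ) * fluctOrder τ n :=
    (natCast_rpow_mul_rpow_eventuallyEq (by ring)).symm.trans_isBigO ((isBigO_refl _ _).mul
      ((isBigO_rpow_fluctOrder_left τ).comp_tendsto tendsto_natCast_atTop_atTop))
  refine EventuallyEq.trans_isTheta (.of_forall fun n => ?_) (hbowTie.add_isLittleO
    (((hdiamond.add htriangle).add herror).trans_isBigO hdominated))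
  simp only [Pi.add_apply]
  ring

end TriangleFluctuations

section RelativeFluctuation

variable {τ hmin : ℝ}

lemma relFluct_nonneg (τ hmin : ℝ) (n : ℕ) : 0 ≤ relFluct τ hmin n :=
  div_nonneg (variance_nonneg _ _) (sq_nonneg _)

lemma relFluct_eq_motifCount (τ hmin : ℝ) (n : ℕ) :
    relFluct τ hmin n
      = var τ hmin n (motifCount triangle) / expect τ hmin n (motifCount triangle) ^ 2 := by
  simp only [relFluct, var, expect, motifCount_triangle]
  rw [variance_const_mul, integral_const_mul, mul_pow, mul_div_mul_left _ _ (by norm_num)]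

theorem isTheta_relFluct (hτ : 2 < τ) (hτ' : τ < 3) (hhmin : 0 < hmin) :
    relFluct τ hmin =Θ[atTop] fun n : ℕ => fluctOrder τ n := by
  rw [funext (relFluct_eq_motifCount τ hmin)]
  refine ((isTheta_var_motifCount_triangle hτ hτ' hhmin).div
    (isTheta_expect_triangle_sq hτ hτ' hhmin)).trans_eventuallyEq ?_
  filter_upwards [eventually_gt_atTop 0] with n hn
  exact mul_div_cancel_left₀ _ (Real.rpow_pos_of_pos (Nat.cast_pos.2 hn) _).ne'

theorem tendsto_relFluct_zero (hτ : 2 < τ) (hτ' : τ < 5 / 2) (hhmin : 0 < hmin) :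
    Tendsto (relFluct τ hmin) atTop (𝓝 0) :=
  (isTheta_relFluct hτ (by linarith) hhmin).tendsto_zero_iff.2
    ((tendsto_fluctOrder_zero hτ').comp tendsto_natCast_atTop_atTop)

theorem isTheta_relFluct_one (hτ : τ = 5 / 2) (hhmin : 0 < hmin) :
    relFluct τ hmin =Θ[atTop] fun _ => (1 : ℝ) := by
  have h := isTheta_relFluct (τ := τ) (by linarith) (by linarith) hhmin
  simpa only [fluctOrder_of_gt (show 7 / 3 < τ by linarith), show 2 * τ - 5 = 0 by linarith,
    Real.rpow_zero] using h

theorem tendsto_relFluct_atTop (hτ : 5 / 2 < τ) (hτ' : τ < 3) (hhmin : 0 < hmin) :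
    Tendsto (relFluct τ hmin) atTop atTop := by
  have h := (isTheta_relFluct (τ := τ) (by linarith) hτ' hhmin).tendsto_norm_atTop_iff.2
    (tendsto_norm_atTop_atTop.comp
      ((tendsto_fluctOrder_atTop hτ).comp tendsto_natCast_atTop_atTop))
  exact h.congr fun n => Real.norm_of_nonneg (relFluct_nonneg τ hmin n)

theorem tendsto_relFluct_zero_iff (hτ : 2 < τ) (hτ' : τ < 3) (hhmin : 0 < hmin) :
    Tendsto (relFluct τ hmin) atTop (𝓝 0) ↔ τ < 5 / 2 := by
  refine ⟨fun h => ?_, fun h => tendsto_relFluct_zero hτ h hhmin⟩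
  by_contra! hge
  obtain heq | hgt := hge.eq_or_lt
  · exact one_ne_zero (tendsto_const_nhds_iff.1
      ((isTheta_relFluct_one heq.symm hhmin).tendsto_zero_iff.1 h))
  · exact not_tendsto_nhds_of_tendsto_atTop (tendsto_relFluct_atTop hgt hτ' hhmin) 0 h

end RelativeFluctuation

end HiddenVariable

theorem mainTheorem7 (τ hmin : ℝ) (hτ : 2 < τ) (hτ' : τ < 3) (hhmin : 0 < hmin) :
    -- labelled triangles are counted six times
    (∀ (n : ℕ) (G : SimpleGraph (Fin n)),
      HiddenVariable.motifCount HiddenVariable.triangle G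
        = 6 * HiddenVariable.triangleCount G) ∧
    -- the variance identity for labelled counts
    ((fun n : ℕ =>
        HiddenVariable.var τ hmin n (HiddenVariable.motifCount HiddenVariable.triangle)
          - (9 * HiddenVariable.expect τ hmin n
                (HiddenVariable.motifCount HiddenVariable.bowTie)
              + 18 * HiddenVariable.expect τ hmin n
                (HiddenVariable.motifCount HiddenVariable.diamond)
              + 6 * HiddenVariable.expect τ hmin n
                (HiddenVariable.motifCount HiddenVariable.triangle)))
      =O[atTop] fun n : ℕ =>
        (n : ℝ)⁻¹ * HiddenVariable.expect τ hmin n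
          (HiddenVariable.motifCount HiddenVariable.triangle) ^ 2) ∧
    -- the order of the relative fluctuation
    (τ < 7 / 3 →
      (fun n : ℕ => HiddenVariable.relFluct τ hmin n)
        =Θ[atTop] fun n : ℕ => (n : ℝ) ^ ((τ - 3) / 2)) ∧
    (τ = 7 / 3 →
      (fun n : ℕ => HiddenVariable.relFluct τ hmin n)
        =Θ[atTop] fun n : ℕ => (n : ℝ) ^ (2 * τ - 5) * Real.log n) ∧
    (7 / 3 < τ →
      (fun n : ℕ => HiddenVariable.relFluct τ hmin n)
        =Θ[atTop] fun n : ℕ => (n : ℝ) ^ (2 * τ - 5)) ∧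
    -- the limits, and the classification
    (τ < 5 / 2 → Tendsto (fun n : ℕ => HiddenVariable.relFluct τ hmin n) atTop (𝓝 0)) ∧
    (τ = 5 / 2 → (fun n : ℕ => HiddenVariable.relFluct τ hmin n) =Θ[atTop] fun _ : ℕ => (1 : ℝ)) ∧
    (5 / 2 < τ → Tendsto (fun n : ℕ => HiddenVariable.relFluct τ hmin n) atTop atTop) ∧
    (Tendsto (fun n : ℕ => HiddenVariable.relFluct τ hmin n) atTop (𝓝 0) ↔ τ < 5 / 2) := by
  open HiddenVariable in
  exact ⟨fun _ G => motifCount_triangle G,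
    isBigO_var_motifCount_triangle_sub (by linarith) hhmin,
    fun h => by simpa only [fluctOrder_of_lt h] using isTheta_relFluct hτ hτ' hhmin,
    fun h => by simpa only [fluctOrder_of_eq h] using isTheta_relFluct hτ hτ' hhmin,
    fun h => by simpa only [fluctOrder_of_gt h] using isTheta_relFluct hτ hτ' hhmin,
    fun h => tendsto_relFluct_zero hτ h hhmin,
    fun h => isTheta_relFluct_one h hhmin,
    fun h => tendsto_relFluct_atTop h hτ' hhmin,
    tendsto_relFluct_zero_iff hτ hτ' hhmin⟩
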